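/- For $J\in\{0,\tfrac12,1,\dots\}$ let $|J,m\rangle$, $m=-J,\dots,J$, be the standard $J_z$-eigenbasis of a spin-$J$ system, let $U_{g,J}$ be the spin-$J$ unitary matrix of a rotation $g$ (an element of $\mathrm{SU}(2)$; the density matrices below depend only on the corresponding element of $\mathrm{SO}(3)$), and let $$|\Phi_{g,J}\rangle=(U_{g,J}\otimes I)\,\frac{1}{\sqrt{2J+1}}\sum_{m=-J}^{J}|J,m\rangle\otimes|J,m\rangle$$ be the rotated spin-$J$ Bell state. A Cartesian refbit is the state $|\Phi_{g,1/2}\rangle$. A probabilistic machine is a completely positive trace-non-increasing linear map $\mathcal M$ from operators on $N$ pairs of spin-$J$ systems to operators on $M$ pairs of spin-$\tfrac12$ systems, independent of $g$. With $dg$ the normalized Haar measure, its success probability is $p_{\rm succ}=\int dg\,\mathrm{Tr}\big[\mathcal M\big(|\Phi_{g,J}\rangle\langle\Phi_{g,J}|^{\otimes N}\big)\big]$ and its fidelity, defined when $p_{\rm succ}>0$, is $$F=\frac{1}{p_{\rm succ}}\int dg\ \langle\Phi_{g,1/2}|^{\otimes M}\,\mathcal M\big(|\Phi_{g,J}\rangle\langle\Phi_{g,J}|^{\otimes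 N}\big)\,|\Phi_{g,1/2}\rangle^{\otimes M}.$$ Then for all integers $N\ge 2$ and $M\ge 0$ and all $J$ there is a probabilistic machine with $p_{\rm succ}>0$ and $$F\ \ge\ 1-(M+1)\exp\!\left[-\frac{2N^2J^2}{M+1}\right].$$ Moreover, the machines can be chosen such that the error $1-F$ vanishes when $M\ll N^2J^2$: for every $\varepsilon>0$ there is $\delta>0$ such that $F\ge 1-\varepsilon$ for all $N\ge2$, $J$ and $M$ with $M\le\delta N^2J^2$. -/

import Mathlib

open scoped Matrix Kronecker ComplexOrder

/-- The group `SU(2)`, which acts on a spin-`J` system by rotations. -/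
abbrev SU2 : Type := Matrix.specialUnitaryGroup (Fin 2) ℂ

instance SU2.instIsTopologicalGroup : IsTopologicalGroup SU2 where
  continuous_mul := continuous_mul
  continuous_inv := by
    refine continuous_induced_rng.2 ?_
    exact continuous_subtype_val.star

instance SU2.instCompactSpace : CompactSpace SU2 := by
  refine isCompact_iff_compactSpace.1 ?_
  have hK : IsCompact (Set.pi Set.univ fun _ : Fin 2 => Set.pi Set.univ fun _ : Fin 2 =>
      Metric.closedBall (0 : ℂ) 1) :=
    isCompact_univ_pi fun _ => isCompact_univ_pi fun _ => isCompact_closedBall 0 1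
  refine IsCompact.of_isClosed_subset hK ?_ ?_
  · have h : ((Matrix.specialUnitaryGroup (Fin 2) ℂ : Submonoid (Matrix (Fin 2) (Fin 2) ℂ)) :
        Set (Matrix (Fin 2) (Fin 2) ℂ)) = {A | A * star A = 1} ∩ {A | A.det = 1} := by
      ext A
      simp [Matrix.mem_specialUnitaryGroup_iff, Matrix.mem_unitaryGroup_iff]
    exact h ▸ (isClosed_eq (continuous_id.mul continuous_id.star) continuous_const).inter
      (isClosed_eq continuous_id.matrix_det continuous_const)
  · intro A hA i _ j _
    simpa using entry_norm_bound_of_unitary (Matrix.mem_specialUnitaryGroup_iff.1 hA).1 i j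

noncomputable instance SU2.instMeasurableSpace : MeasurableSpace SU2 := borel SU2

instance SU2.instBorelSpace : BorelSpace SU2 := ⟨rfl⟩

/-- The Haar measure `dg` on `SU(2)`, normalized so that the whole group has measure `1`.
On functions invariant under `g ↦ -g` it is the normalized Haar average over the rotation group
`SO(3) = SU(2) / {1, -1}`. -/
noncomputable def haarSU2 : MeasureTheory.Measure SU2 :=
  MeasureTheory.Measure.haarMeasure ⊤

/-- The Hilbert space of a spin-`J` system, with `d = 2 * J`, has the orthonormal basis
`|J, m⟩` with `m = -J, …, J`; the index `k : Fin (d + 1)` stands for `m = k - J`.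

`spinMatrix d g` is the unitary matrix `U_{g,J}` of `g` in this basis. It is the action
`x ↦ g₀₀ x + g₁₀ y`, `y ↦ g₀₁ x + g₁₁ y` on homogeneous polynomials of degree `d`, with
`|J, m⟩ = √(d choose k) x ^ k y ^ (d - k)`. The polynomials are written at `y = 1`. -/
noncomputable def spinMatrix (d : ℕ) (g : SU2) : Matrix (Fin (d + 1)) (Fin (d + 1)) ℂ :=
  Matrix.of fun l k =>
    ((Real.sqrt (d.choose k) / Real.sqrt (d.choose l) : ℝ) : ℂ) *
      ((Polynomial.C (g.1 0 0) * Polynomial.X + Polynomial.C (g.1 1 0)) ^ (k : ℕ) *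
        (Polynomial.C (g.1 0 1) * Polynomial.X + Polynomial.C (g.1 1 1)) ^ (d - (k : ℕ))).coeff
        (l : ℕ)

/-- Basis labels of a pair of spin-`d/2` systems. -/
abbrev SpinPair (d : ℕ) : Type := Fin (d + 1) × Fin (d + 1)

/-- The standard Bell state `|Φ_J⟩ = (2J + 1)^(-1/2) ∑ₘ |J, m⟩ ⊗ |J, m⟩`, with `d = 2 * J`. -/
noncomputable def bellState (d : ℕ) : SpinPair d → ℂ :=
  fun p => if p.1 = p.2 then ((1 / Real.sqrt (d + 1) : ℝ) : ℂ) else 0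

/-- The rotated Bell state `|Φ_{g,J}⟩ = (U_{g,J} ⊗ I) |Φ_J⟩`. -/
noncomputable def rotatedBellState (d : ℕ) (g : SU2) : SpinPair d → ℂ :=
  (spinMatrix d g ⊗ₖ (1 : Matrix (Fin (d + 1)) (Fin (d + 1)) ℂ)) *ᵥ bellState d

/-- The vector `|Φ_{g,J}⟩^{⊗ N}` of `N` pairs. -/
noncomputable def bellCopies (N d : ℕ) (g : SU2) : (Fin N → SpinPair d) → ℂ :=
  fun s => ∏ i, rotatedBellState d g (s i)

/-- The density matrix `|ψ⟩⟨ψ|` of a vector `ψ`. -/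
def pureState {m : Type*} (ψ : m → ℂ) : Matrix m m ℂ :=
  Matrix.vecMulVec ψ (star ψ)

/-- A quantum operation (probabilistic machine): a completely positive, trace-non-increasing linear
map from matrices on the input space to matrices on the output space. -/
structure QuantumOperation (m n : Type*) [Fintype m] [Fintype n] where
  /-- The underlying linear map. -/
  toLinearMap : Matrix m m ℂ →ₗ[ℂ] Matrix n n ℂ
  /-- Applying the map to the second factor of `ℂ^k ⊗ ℂ^m` preserves positivity, for every `k`. -/
  completelyPositive : ∀ (k : ℕ) (X : Matrix (Fin k × m) (Fin k × m) ℂ), X.PosSemidef →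
    (Matrix.of fun p q : Fin k × n =>
      toLinearMap (Matrix.of fun a b => X (p.1, a) (q.1, b)) p.2 q.2).PosSemidef
  /-- The trace does not increase on positive matrices. -/
  trace_le : ∀ ρ : Matrix m m ℂ, ρ.PosSemidef → (toLinearMap ρ).trace.re ≤ ρ.trace.re

/-- A machine that converts `N` pairs of spin-`d/2` systems into `M` pairs of spin-`e/2` systems. -/
abbrev BellMachine (N d M e : ℕ) : Type :=
  QuantumOperation (Fin N → SpinPair d) (Fin M → SpinPair e)

/-- The unnormalized output of a machine on the input `|Φ_{g,J}⟩⟨Φ_{g,J}|^{⊗ N}`. -/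
noncomputable def BellMachine.output {N d M e : ℕ} (𝓜 : BellMachine N d M e) (g : SU2) :
    Matrix (Fin M → SpinPair e) (Fin M → SpinPair e) ℂ :=
  𝓜.toLinearMap (pureState (bellCopies N d g))

/-- The total success probability `∫ dg Tr[𝓜(|Φ_{g,J}⟩⟨Φ_{g,J}|^{⊗ N})]`. -/
noncomputable def BellMachine.successProb {N d M e : ℕ} (𝓜 : BellMachine N d M e) : ℝ :=
  ∫ g, (𝓜.output g).trace.re ∂haarSU2

/-- The probabilistic fidelity of the conversion `|Φ_{g,J}⟩^{⊗ N} → |Φ_{g,K}⟩^{⊗ M}`, that is, the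
average of the fidelity of the normalized output over the rotation conditioned on success:
`∫ dg ⟨Φ_{g,K}|^{⊗ M} 𝓜(|Φ_{g,J}⟩⟨Φ_{g,J}|^{⊗ N}) |Φ_{g,K}⟩^{⊗ M}` divided by the success
probability. -/
noncomputable def BellMachine.fidelity {N d M e : ℕ} (𝓜 : BellMachine N d M e) : ℝ :=
  (∫ g, (star (bellCopies M e g) ⬝ᵥ (𝓜.output g *ᵥ bellCopies M e g)).re ∂haarSU2) /
    𝓜.successProb

/-! Put `d = 2J` and `n = N * d`. The amplitudes of `|Φ_{g,J}⟩^{⊗ N}` are, up to constants, products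
of `N` matrix coefficients of the spin-`J` representation, so a fixed linear map turns this state
into any vector whose amplitudes, as functions of `g`, lie in the `N`-th power of `coeffSpace`. For
`N ≥ 2` the Clebsch-Gordan series puts into that power the matrix coefficients of every spin `k / 2`
with `k ≤ n` and `k ≡ n` mod 2 (`span_pow_le_coeffSpace_pow`). Hence, if `L ≡ n` mod 2, the
projection of `L` refbits to total spin at most `n / 2` can be produced exactly, up to a scalar
(`exists_projected_bellCopies`).

Let `q` be the fraction of the `2 ^ L` dimensions of `L` qubits that lies in this low spin part. The
projected vector has squared norm `q` and overlap `q` with the `L` refbits, so its fidelity is `q`.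
Parity is arranged by taking `L = M` or `L = M + 1`, and discarding the extra refbit does not lower
the fidelity (`exists_bellMachine`).

The low spin part is built by hand: words in two letters, read as parentheses, index a basis of the
`L`-qubit space in which matched pairs carry singlets and only the unmatched letters feel the
rotation. Counting words by unmatched letters becomes counting walks on `ℕ`. The weight `1 - q` is
then bounded twice: a Chernoff bound gives the exponential estimate, and a Markov bound on the
Casimir operator gives the second claim, which the Chernoff bound misses because its prefactor grows
with `M`. -/

/-! ### Clebsch-Gordan inclusions between spaces of matrix coefficients. -/

section MatrixCoefficients

open Polynomial

variable {𝒜 : Type*} [CommRing 𝒜] [Algebra ℂ 𝒜]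

/-- If a polynomial takes values in a subspace at all but one point of `ℂ`, then its coefficients
lie in the subspace. -/
theorem coeff_mem_of_eval_mem (S : Submodule ℂ 𝒜) (P : 𝒜[X]) (x₀ : ℂ)
    (h : ∀ y : ℂ, y ≠ x₀ → P.eval (algebraMap ℂ 𝒜 y) ∈ S) (l : ℕ) : P.coeff l ∈ S := by
  by_contra hl
  -- A functional that kills `S` but not this coefficient, applied coefficientwise to `P`, gives a
  -- scalar polynomial with infinitely many roots.
  obtain ⟨φ, hφ, hS⟩ := Submodule.exists_le_ker_of_notMem hl
  set p : ℂ[X] := ∑ i ∈ Finset.range (P.natDegree + 1), Polynomial.monomial i (φ (P.coeff i)) with hp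
  have hev : ∀ y : ℂ, p.eval y = φ (P.eval (algebraMap ℂ 𝒜 y)) := by
    intro y
    rw [Polynomial.eval_eq_sum_range (p := P), map_sum, hp, Polynomial.eval_finsetSum]
    refine Finset.sum_congr rfl fun i _ => ?_
    rw [Polynomial.eval_monomial, ← map_pow, mul_comm (P.coeff i), ← Algebra.smul_def, map_smul,
      smul_eq_mul, mul_comm]
  have hzero : p = 0 := by
    refine Polynomial.eq_zero_of_infinite_isRoot p ?_
    refine Set.Infinite.mono (s := {x₀}ᶜ) ?_ (Set.finite_singleton x₀).infinite_compl
    intro y hy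
    have := hS (h y hy)
    simpa [Polynomial.IsRoot, hev] using this
  have hc : p.coeff l = φ (P.coeff l) := by
    rw [hp, Polynomial.finsetSum_coeff]
    simp only [Polynomial.coeff_monomial]
    rw [Finset.sum_ite_eq' ]
    split_ifs with hmem
    · rfl
    · rw [Polynomial.coeff_eq_zero_of_natDegree_lt (by simpa using hmem), map_zero]
  rw [hzero] at hc
  exact hφ (by simpa using hc.symm)

theorem eval_mem_of_coeff_mem (S : Submodule ℂ 𝒜) (P : 𝒜[X]) (h : ∀ l, P.coeff l ∈ S) (y : ℂ) :
    P.eval (algebraMap ℂ 𝒜 y) ∈ S := by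
  rw [Polynomial.eval_eq_sum_range]
  refine Submodule.sum_mem _ fun i _ => ?_
  rw [← map_pow, mul_comm, ← Algebra.smul_def]
  exact S.smul_mem _ (h i)

/-- The polynomial `(a X + c) ^ k (b X + e) ^ l`. -/
noncomputable def rowPoly (a b c e : 𝒜) (k l : ℕ) : 𝒜[X] :=
  (C a * X + C c) ^ k * (C b * X + C e) ^ l

/-- The span of the matrix coefficients of the spin-`d/2` representation, for a matrix with
entries `a b c e`. -/
noncomputable def coeffSpace (a b c e : 𝒜) (d : ℕ) : Submodule ℂ 𝒜 :=
  Submodule.span ℂ {f | ∃ k l m, k + l = d ∧ f = (rowPoly a b c e k l).coeff m}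

variable {a b c e : 𝒜}

theorem coeff_rowPoly_mem {k l d : ℕ} (h : k + l = d) (m : ℕ) :
    (rowPoly a b c e k l).coeff m ∈ coeffSpace a b c e d :=
  Submodule.subset_span ⟨k, l, m, h, rfl⟩

theorem eval_rowPoly_mem {k l d : ℕ} (h : k + l = d) (x : ℂ) :
    (rowPoly a b c e k l).eval (algebraMap ℂ 𝒜 x) ∈ coeffSpace a b c e d :=
  eval_mem_of_coeff_mem _ _ (coeff_rowPoly_mem h) x

omit [Algebra ℂ 𝒜] in
theorem eval_rowPoly (k l : ℕ) (x : 𝒜) :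
    (rowPoly a b c e k l).eval x = (a * x + c) ^ k * (b * x + e) ^ l := by
  simp [rowPoly]

/-- The Clebsch-Gordan series, as an inclusion of spaces of matrix coefficients. -/
theorem coeffSpace_le_mul (h : a * e - b * c = 1) {m d i : ℕ} (hm : i ≤ m) (hd : i ≤ d) :
    coeffSpace a b c e (m + d - 2 * i) ≤ coeffSpace a b c e m * coeffSpace a b c e d := by
  set S := coeffSpace a b c e m * coeffSpace a b c e d
  have key : ∀ k₁ l₁ k₂ l₂ : ℕ, k₁ + l₁ + i = m → k₂ + l₂ + i = d → ∀ x y : ℂ, y ≠ x →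
      (rowPoly a b c e k₁ l₁).eval (algebraMap ℂ 𝒜 x) *
        (rowPoly a b c e k₂ l₂).eval (algebraMap ℂ 𝒜 y) ∈ S := by
    intro k₁ l₁ k₂ l₂ h₁ h₂ x y hxy
    have hne : (x - y) ^ i ≠ 0 := pow_ne_zero _ (sub_ne_zero.2 hxy.symm)
    rw [← S.smul_mem_iff hne]
    -- The singlet: by the determinant condition `x - y` is the antisymmetric product of the linear
    -- forms at `x` and `y`. Expanding its `i`-th power raises the degrees `m - i` and `d - i` to
    -- `m` and `d`.
    have hdet : algebraMap ℂ 𝒜 (x - y) =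
        (a * algebraMap ℂ 𝒜 x + c) * (b * algebraMap ℂ 𝒜 y + e) +
          -((b * algebraMap ℂ 𝒜 x + e) * (a * algebraMap ℂ 𝒜 y + c)) := by
      rw [map_sub]
      linear_combination (algebraMap ℂ 𝒜 y - algebraMap ℂ 𝒜 x) * h
    rw [Algebra.smul_def, map_pow, hdet, add_pow, Finset.sum_mul]
    refine Submodule.sum_mem _ fun j hj => ?_
    have hj' : j ≤ i := by simpa [Nat.lt_succ_iff] using hj
    have e1 := eval_rowPoly_mem (a := a) (b := b) (c := c) (e := e)
      (k := k₁ + j) (l := l₁ + (i - j)) (d := m) (by omega) x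
    have e2 := eval_rowPoly_mem (a := a) (b := b) (c := c) (e := e)
      (k := k₂ + (i - j)) (l := l₂ + j) (d := d) (by omega) y
    have := S.smul_mem ((-1) ^ (i - j) * (i.choose j : ℂ)) (Submodule.mul_mem_mul e1 e2)
    convert this using 1
    rw [Algebra.smul_def]
    simp only [eval_rowPoly, map_mul, map_pow, map_neg, map_one, map_natCast]
    generalize a * algebraMap ℂ 𝒜 x + c = α₁
    generalize b * algebraMap ℂ 𝒜 x + e = β₁
    generalize a * algebraMap ℂ 𝒜 y + c = α₂
    generalize b * algebraMap ℂ 𝒜 y + e = β₂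
    rw [neg_pow]
    ring
  refine Submodule.span_le.2 ?_
  rintro _ ⟨k, l, n, hkl, rfl⟩
  refine coeff_mem_of_eval_mem S _ 0 (fun x _ => ?_) n
  obtain ⟨k₁, l₁, k₂, l₂, h₁, h₂, rfl, rfl⟩ : ∃ k₁ l₁ k₂ l₂ : ℕ,
      k₁ + l₁ + i = m ∧ k₂ + l₂ + i = d ∧ k = k₁ + k₂ ∧ l = l₁ + l₂ := by
    refine ⟨min k (m - i), m - i - min k (m - i), k - min k (m - i),
      l - (m - i - min k (m - i)), ?_, ?_, ?_, ?_⟩ <;> omega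
  -- The division by `(x - y) ^ i` excludes `y = x`, but a polynomial in `y` with values in `S` off
  -- one point has its coefficients in `S`, hence its value at `y = x` too.
  have hmem := eval_mem_of_coeff_mem S
    (C ((rowPoly a b c e k₁ l₁).eval (algebraMap ℂ 𝒜 x)) * rowPoly a b c e k₂ l₂)
    (coeff_mem_of_eval_mem S _ x fun y hy => by
      rw [eval_mul, eval_C]; exact key k₁ l₁ k₂ l₂ h₁ h₂ x y hy) x
  rw [eval_mul, eval_C] at hmem
  convert hmem using 1
  simp only [eval_rowPoly]
  ring

/-- Two spins `d / 2` already couple to every integer spin up to `d`. A further factor reaches spin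
`k / 2` from `|k - d| / 2`, which the previous power contains. The induction starts at two because a
single factor contains only `k = d`. -/
theorem coeffSpace_le_pow (h : a * e - b * c = 1) (d : ℕ) {N : ℕ} (hN : 2 ≤ N) :
    ∀ k, k ≤ N * d → k % 2 = (N * d) % 2 →
      coeffSpace a b c e k ≤ coeffSpace a b c e d ^ N := by
  induction N, hN using Nat.le_induction with
  | base =>
    intro k hk hp
    have := coeffSpace_le_mul h (m := d) (d := d) (i := (2 * d - k) / 2) (by omega) (by omega)
    rwa [show d + d - 2 * ((2 * d - k) / 2) = k by omega, ← pow_two] at this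
  | succ N hN ih =>
    intro k hk hp
    have hNd : d ≤ N * d := Nat.le_mul_of_pos_left d (by omega)
    rw [Nat.succ_mul] at hk hp
    rw [pow_succ]
    rcases le_total d k with hdk | hdk
    · have := coeffSpace_le_mul h (m := k - d) (d := d) (i := 0) (by omega) (by omega)
      rw [show k - d + d - 2 * 0 = k by omega] at this
      exact this.trans (mul_le_mul' (ih (k - d) (by omega) (by omega)) le_rfl)
    · have := coeffSpace_le_mul h (m := d - k) (d := d) (i := d - k) (by omega) (by omega)
      rw [show d - k + d - 2 * (d - k) = k by omega] at this
      exact this.trans (mul_le_mul' (ih (d - k) (by omega) (by omega)) le_rfl)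

theorem coeff_derivative_mem (S : Submodule ℂ 𝒜) {P : 𝒜[X]} (h : ∀ l, P.coeff l ∈ S) (l : ℕ) :
    (derivative P).coeff l ∈ S := by
  rw [coeff_derivative]
  have := S.smul_mem ((l : ℂ) + 1) (h (l + 1))
  rw [Algebra.smul_def] at this
  simpa [mul_comm] using this

theorem coeff_X_mul_mem (S : Submodule ℂ 𝒜) {P : 𝒜[X]} (h : ∀ l, P.coeff l ∈ S) (l : ℕ) :
    (X * P).coeff l ∈ S := by
  cases l with
  | zero => simp
  | succ l => simpa using h l

/-- Multiplying by a spin `1/2` moves the spin by at most `1/2`. With `α = aX + c` and `β = bX + e`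
the determinant condition reads `aβ - bα = 1`, so the derivative of `α ^ (p + 1) * β ^ q` is `(p + q
+ 1) a α ^ p β ^ q - q α ^ p β ^ (q - 1)`. -/
theorem span_mul_coeffSpace_le (h : a * e - b * c = 1) {k : ℕ} {S : Submodule ℂ 𝒜}
    (h₁ : coeffSpace a b c e (k + 1) ≤ S)
    (h₂ : ∀ j, j + 1 = k → coeffSpace a b c e j ≤ S) :
    Submodule.span ℂ {a, b, c, e} * coeffSpace a b c e k ≤ S := by
  rw [coeffSpace, Submodule.span_mul_span, Submodule.span_le]
  have hC : (C a * C e - C b * C c : 𝒜[X]) = 1 := by rw [← C_mul, ← C_mul, ← C_sub, h, C_1]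
  have hk0 : ((k : ℂ) + 1) ≠ 0 := by exact_mod_cast Nat.succ_ne_zero k
  -- the products with `a` and `b` are read off from a derivative
  have hmain : ∀ p q, p + q = k → (∀ m, (C a * rowPoly a b c e p q).coeff m ∈ S) ∧
      (∀ m, (C b * rowPoly a b c e p q).coeff m ∈ S) := by
    intro p q hpq
    constructor
    · intro m
      rw [← S.smul_mem_iff hk0]
      have e1 := coeff_derivative_mem S (P := rowPoly a b c e (p + 1) q)
        (fun l => h₁ (coeff_rowPoly_mem (by omega) l)) m
      have e2 : (C (q : 𝒜) * rowPoly a b c e p (q - 1)).coeff m ∈ S := by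
        rcases Nat.eq_zero_or_pos q with rfl | hq
        · simp
        · rw [coeff_C_mul, ← nsmul_eq_mul]
          exact S.smul_of_tower_mem _ (h₂ (p + (q - 1)) (by omega) (coeff_rowPoly_mem rfl m))
      convert S.add_mem e1 e2 using 1
      rw [← coeff_add, Algebra.smul_def, ← coeff_C_mul]
      congr 1
      subst hpq
      rcases q with _ | q
      · simp [rowPoly, derivative_mul, derivative_pow]
        ring
      · simp only [rowPoly, derivative_mul, derivative_pow, derivative_C,
          derivative_X, map_add, map_natCast, map_one, Nat.add_sub_cancel]
        push_cast
        linear_combination ((q + 1 : 𝒜[X])) * ((C a * X + C c) ^ p * (C b * X + C e) ^ q) * hC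
    · intro m
      rw [← S.smul_mem_iff hk0]
      have e1 := coeff_derivative_mem S (P := rowPoly a b c e p (q + 1))
        (fun l => h₁ (coeff_rowPoly_mem (by omega) l)) m
      have e2 : (C (p : 𝒜) * rowPoly a b c e (p - 1) q).coeff m ∈ S := by
        rcases Nat.eq_zero_or_pos p with rfl | hq
        · simp
        · rw [coeff_C_mul, ← nsmul_eq_mul]
          exact S.smul_of_tower_mem _ (h₂ (p - 1 + q) (by omega) (coeff_rowPoly_mem rfl m))
      convert S.sub_mem e1 e2 using 1
      rw [← coeff_sub, Algebra.smul_def, ← coeff_C_mul]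
      congr 1
      subst hpq
      rcases p with _ | p
      · simp [rowPoly, derivative_mul, derivative_pow]
        ring
      · simp only [rowPoly, derivative_mul, derivative_pow, derivative_C,
          derivative_X, map_add, map_natCast, map_one, Nat.add_sub_cancel]
        push_cast
        linear_combination (-(p + 1 : 𝒜[X])) * ((C a * X + C c) ^ p * (C b * X + C e) ^ q) * hC
  rintro _ ⟨f, hf, _, ⟨p, q, m, hpq, rfl⟩, rfl⟩
  obtain ⟨ha, hb⟩ := hmain p q hpq
  simp only [Set.mem_insert_iff, Set.mem_singleton_iff] at hf
  rcases hf with rfl | rfl | rfl | rfl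
  · simpa using ha m
  · simpa using hb m
  · have e1 := h₁ (coeff_rowPoly_mem (a := a) (b := b) (c := f) (e := e)
      (k := p + 1) (l := q) (by omega) m)
    have := S.sub_mem e1 (coeff_X_mul_mem S ha m)
    rw [← coeff_sub] at this
    show f * _ ∈ S
    rw [← coeff_C_mul]
    rwa [show C f * rowPoly a b f e p q =
      rowPoly a b f e (p + 1) q - X * (C a * rowPoly a b f e p q) by simp only [rowPoly]; ring]
  · have e1 := h₁ (coeff_rowPoly_mem (a := a) (b := b) (c := c) (e := f)
      (k := p) (l := q + 1) (by omega) m)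
    have := S.sub_mem e1 (coeff_X_mul_mem S hb m)
    rw [← coeff_sub] at this
    show f * _ ∈ S
    rw [← coeff_C_mul]
    rwa [show C f * rowPoly a b c f p q =
      rowPoly a b c f p (q + 1) - X * (C b * rowPoly a b c f p q) by simp only [rowPoly]; ring]

/-- Each factor shifts the doubled spin by one up or down, which fixes the parity of `j`. -/
theorem span_pow_le_iSup_coeffSpace (h : a * e - b * c = 1) (k : ℕ) :
    Submodule.span ℂ {a, b, c, e} ^ k ≤
      ⨆ (j : ℕ) (_ : j ≤ k ∧ j % 2 = k % 2), coeffSpace a b c e j := by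
  induction k with
  | zero =>
    rw [pow_zero, Submodule.one_eq_span, Submodule.span_le, Set.singleton_subset_iff]
    refine Submodule.mem_iSup_of_mem 0 (Submodule.mem_iSup_of_mem ⟨le_rfl, rfl⟩ ?_)
    simpa [rowPoly] using coeff_rowPoly_mem (a := a) (b := b) (c := c) (e := e)
      (k := 0) (l := 0) (d := 0) rfl 0
  | succ k ih =>
    rw [pow_succ']
    refine (mul_le_mul' le_rfl ih).trans ?_
    simp only [Submodule.mul_iSup]
    refine iSup_le fun j => iSup_le fun hj => span_mul_coeffSpace_le h ?_ ?_
    · exact le_iSup₂_of_le (j + 1) (by omega) le_rfl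
    · intro i hi
      exact le_iSup₂_of_le i (by omega) le_rfl

theorem span_pow_le_coeffSpace_pow (h : a * e - b * c = 1) {d N k : ℕ} (hN : 2 ≤ N)
    (hk : k ≤ N * d) (hp : k % 2 = (N * d) % 2) :
    Submodule.span ℂ {a, b, c, e} ^ k ≤ coeffSpace a b c e d ^ N :=
  (span_pow_le_iSup_coeffSpace h k).trans
    (iSup_le fun j => iSup_le fun hj =>
      coeffSpace_le_pow h d hN j (hj.1.trans hk) (hj.2.trans hp))

end MatrixCoefficients

/-! ### A basis of the tensor power of `ℂ²` indexed by parenthesis words. -/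

section Words

/-- The sum of a function over all words of length `L` in the letters `0` and `1`. -/
def wordSum {R : Type*} [AddCommMonoid R] : ℕ → (List (Fin 2) → R) → R
  | 0, f => f []
  | L + 1, f => wordSum L (fun w => f (0 :: w)) + wordSum L (fun w => f (1 :: w))

theorem wordSum_congr {R : Type*} [AddCommMonoid R] (L : ℕ) {f f' : List (Fin 2) → R}
    (h : ∀ w, w.length = L → f w = f' w) : wordSum L f = wordSum L f' := by
  induction L generalizing f f' with
  | zero => exact h [] rfl
  | succ L ih =>
    simp only [wordSum]
    rw [ih fun w hw => h (0 :: w) (by simp [hw]), ih fun w hw => h (1 :: w) (by simp [hw])]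

theorem wordSum_eq_sum {R : Type*} [AddCommMonoid R] (L : ℕ) (f : List (Fin 2) → R) :
    wordSum L f = ∑ x : Fin L → Fin 2, f (List.ofFn x) := by
  induction L generalizing f with
  | zero => simp [wordSum]
  | succ L ih =>
    simp only [wordSum, ih]
    rw [← (Fin.consEquiv fun _ : Fin (L + 1) => Fin 2).sum_comp, Fintype.sum_prod_type,
      Fin.sum_univ_two]
    simp [Fin.consEquiv, List.ofFn_succ]

theorem wordSum_add {R : Type*} [AddCommMonoid R] (L : ℕ) (f f' : List (Fin 2) → R) :
    wordSum L (fun w => f w + f' w) = wordSum L f + wordSum L f' := by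
  simp only [wordSum_eq_sum, Finset.sum_add_distrib]

theorem wordSum_mul_left {R : Type*} [Semiring R] (L : ℕ) (r : R) (f : List (Fin 2) → R) :
    wordSum L (fun w => r * f w) = r * wordSum L f := by
  simp only [wordSum_eq_sum, Finset.mul_sum]

theorem wordSum_zero {R : Type*} [AddCommMonoid R] (L : ℕ) :
    wordSum L (fun _ => (0 : R)) = 0 := by
  simp only [wordSum_eq_sum, Finset.sum_const_zero]

theorem wordSum_mem {R M : Type*} [Semiring R] [AddCommMonoid M] [Module R M]
    (S : Submodule R M) (L : ℕ) (f : List (Fin 2) → M) (h : ∀ w, w.length = L → f w ∈ S) :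
    wordSum L f ∈ S := by
  rw [wordSum_eq_sum]
  exact Submodule.sum_mem _ fun x _ => h _ (by simp)

/-- Read `0` as an opening and `1` as a closing parenthesis: the number of closing parentheses of
the word without a partner. -/
def unmatchedClose : List (Fin 2) → ℕ
  | [] => 0
  | i :: w => if i = 0 then unmatchedClose w - 1 else unmatchedClose w + 1

/-- The number of opening parentheses of the word without a partner. -/
def unmatchedOpen : List (Fin 2) → ℕ
  | [] => 0
  | i :: w => if i = 0 ∧ unmatchedClose w = 0 then unmatchedOpen w + 1 else unmatchedOpen w

/-- The number of letters without a partner. -/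
def unmatched (w : List (Fin 2)) : ℕ := unmatchedClose w + unmatchedOpen w

/-- The letters without a partner, in their order. -/
def unmatchedWord (w : List (Fin 2)) : List (Fin 2) :=
  List.replicate (unmatchedClose w) 1 ++ List.replicate (unmatchedOpen w) 0

/-- `singletInsertion w x y` is the component at `y` of the tensor with a singlet on each matched
pair of letters of `w` and the basis tensor `x` on the letters without a partner. -/
def singletInsertion : List (Fin 2) → List (Fin 2) → List (Fin 2) → ℂ
  | [], x, y => if x = [] ∧ y = [] then 1 else 0
  | i :: w, x, y =>
    match y with
    | [] => 0
    | j :: y =>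
      if i = 0 ∧ unmatchedClose w ≠ 0 then
        if j = 0 then singletInsertion w (1 :: x) y else -singletInsertion w (0 :: x) y
      else
        match x with
        | [] => 0
        | k :: x => if k = j then singletInsertion w x y else 0

theorem singletInsertion_matched {i : Fin 2} {w : List (Fin 2)}
    (h : i = 0 ∧ unmatchedClose w ≠ 0) (x y : List (Fin 2)) (j : Fin 2) :
    singletInsertion (i :: w) x (j :: y) =
      if j = 0 then singletInsertion w (1 :: x) y else -singletInsertion w (0 :: x) y := by
  rw [singletInsertion.eq_def]; exact if_pos h

theorem singletInsertion_unmatched {i : Fin 2} {w : List (Fin 2)}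
    (h : ¬(i = 0 ∧ unmatchedClose w ≠ 0)) (x y : List (Fin 2)) (k j : Fin 2) :
    singletInsertion (i :: w) (k :: x) (j :: y) =
      if k = j then singletInsertion w x y else 0 := by
  rw [singletInsertion.eq_def]; exact if_neg h

theorem unmatched_cons_matched {i : Fin 2} {w : List (Fin 2)}
    (h : i = 0 ∧ unmatchedClose w ≠ 0) : unmatched (i :: w) + 1 = unmatched w := by
  simp only [unmatched, unmatchedClose, unmatchedOpen, h.1, h.2]
  simp; omega

theorem unmatched_cons_unmatched {i : Fin 2} {w : List (Fin 2)}
    (h : ¬(i = 0 ∧ unmatchedClose w ≠ 0)) : unmatched (i :: w) = unmatched w + 1 := by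
  simp only [unmatched, unmatchedClose, unmatchedOpen]
  by_cases hi : i = 0
  · have : unmatchedClose w = 0 := by tauto
    simp [hi, this]
  · simp [hi]; omega

theorem unmatchedWord_length (w : List (Fin 2)) : (unmatchedWord w).length = unmatched w := by
  simp [unmatchedWord, unmatched]

theorem unmatchedWord_matched {i : Fin 2} {w : List (Fin 2)}
    (h : i = 0 ∧ unmatchedClose w ≠ 0) :
    unmatchedWord w = 1 :: unmatchedWord (i :: w) := by
  obtain ⟨n, hn⟩ := Nat.exists_eq_succ_of_ne_zero h.2
  simp [unmatchedWord, unmatchedClose, unmatchedOpen, h.1, hn, List.replicate_succ]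

theorem unmatchedWord_unmatched {i : Fin 2} {w : List (Fin 2)}
    (h : ¬(i = 0 ∧ unmatchedClose w ≠ 0)) :
    unmatchedWord (i :: w) = i :: unmatchedWord w := by
  by_cases hi : i = 0
  · have : unmatchedClose w = 0 := by tauto
    simp [unmatchedWord, unmatchedClose, unmatchedOpen, hi, this, List.replicate_succ]
  · obtain rfl : i = 1 := by omega
    simp [unmatchedWord, unmatchedClose, unmatchedOpen, List.replicate_succ]

theorem unmatched_mod_two (w : List (Fin 2)) : unmatched w % 2 = w.length % 2 := by
  induction w with
  | nil => rfl
  | cons i w ih =>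
    by_cases h : i = 0 ∧ unmatchedClose w ≠ 0
    · have := unmatched_cons_matched h
      simp only [List.length_cons]; omega
    · rw [unmatched_cons_unmatched h, List.length_cons]; omega

/-- The tensor of a word. -/
def wordTensor (w y : List (Fin 2)) : ℂ := singletInsertion w (unmatchedWord w) y

/-- The tensors of the words of length `L` are linearly independent. -/
theorem eq_zero_of_wordSum_wordTensor (L : ℕ) (f : List (Fin 2) → ℂ)
    (h : ∀ y, y.length = L → wordSum L (fun w => f w * wordTensor w y) = 0) :
    ∀ w, w.length = L → f w = 0 := by
  induction L generalizing f with
  | zero =>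
    intro w hw
    obtain rfl := List.length_eq_zero_iff.1 hw
    have := h [] rfl
    simpa [wordSum, wordTensor, unmatchedWord, unmatchedClose, unmatchedOpen, singletInsertion]
      using this
  | succ L ih =>
    -- Triangularity in the first letter: a word starting with `1` has no component at `0 :: y`, so
    -- these components isolate the words starting with `0`; once those are gone, `1 :: y` isolates
    -- the others.
    have h00 : ∀ w y, wordTensor (0 :: w) (0 :: y) = wordTensor w y := by
      intro w y
      by_cases hw : (0 : Fin 2) = 0 ∧ unmatchedClose w ≠ 0
      · rw [wordTensor, singletInsertion_matched hw, if_pos rfl, ← unmatchedWord_matched hw,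
          wordTensor]
      · rw [wordTensor, unmatchedWord_unmatched hw, singletInsertion_unmatched hw, if_pos rfl,
          wordTensor]
    have h1 : ∀ w j y, wordTensor (1 :: w) (j :: y) = if 1 = j then wordTensor w y else 0 := by
      intro w j y
      have hw : ¬((1 : Fin 2) = 0 ∧ unmatchedClose w ≠ 0) := by simp
      rw [wordTensor, unmatchedWord_unmatched hw, singletInsertion_unmatched hw, wordTensor]
    have z0 : ∀ w, w.length = L → f (0 :: w) = 0 := by
      refine ih _ fun y hy => ?_
      have := h (0 :: y) (by simp [hy])
      simpa [wordSum, h00, h1, wordSum_zero] using this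
    have z1 : ∀ w, w.length = L → f (1 :: w) = 0 := by
      refine ih _ fun y hy => ?_
      have := h (1 :: y) (by simp [hy])
      rw [wordSum, wordSum_congr L (f := fun w => f (0 :: w) * _) (f' := fun _ => 0)
        fun w hw => by rw [z0 w hw, zero_mul]] at this
      simpa [h1, wordSum_zero] using this
    intro w hw
    match w with
    | i :: w =>
      have hw' : w.length = L := by simpa using hw
      fin_cases i
      · exact z0 w hw'
      · exact z1 w hw'

variable {𝒜 : Type*} [CommRing 𝒜]

/-- The matrix coefficients of a tensor power of the matrix `β`. -/
def tensorCoeff (β : Fin 2 → Fin 2 → 𝒜) : List (Fin 2) → List (Fin 2) → 𝒜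
  | i :: x, j :: y => β i j * tensorCoeff β x y
  | [], [] => 1
  | _, _ => 0

variable [Algebra ℂ 𝒜]

theorem tensorCoeff_mem (β : Fin 2 → Fin 2 → 𝒜) (V : Submodule ℂ 𝒜) (hV : ∀ i j, β i j ∈ V)
    (x y : List (Fin 2)) : tensorCoeff β x y ∈ V ^ y.length := by
  induction x generalizing y with
  | nil =>
    cases y with
    | nil => simpa [tensorCoeff] using Submodule.one_le.1 (le_refl (1 : Submodule ℂ 𝒜))
    | cons j y => simp [tensorCoeff]
  | cons i x ih =>
    cases y with
    | nil => simp [tensorCoeff]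
    | cons j y =>
      rw [tensorCoeff, List.length_cons, pow_succ']
      exact Submodule.mul_mem_mul (hV i j) (ih y)

/-- Singlets are invariant under matrices of determinant one. -/
theorem wordSum_tensorCoeff_singletInsertion (β : Fin 2 → Fin 2 → 𝒜)
    (hβ : β 0 0 * β 1 1 - β 0 1 * β 1 0 = 1) (w x z : List (Fin 2))
    (hx : x.length = unmatched w) (hz : z.length = w.length) :
    wordSum w.length (fun y => tensorCoeff β z y * algebraMap ℂ 𝒜 (singletInsertion w x y)) =
      wordSum (unmatched w) fun x' =>
        algebraMap ℂ 𝒜 (singletInsertion w x' z) * tensorCoeff β x' x := by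
  induction w generalizing x z with
  | nil =>
    obtain rfl := List.length_eq_zero_iff.1 hz
    obtain rfl := List.length_eq_zero_iff.1 hx
    simp [wordSum, unmatched, unmatchedClose, unmatchedOpen, mul_comm]
  | cons i w ih =>
    match z with
    | j :: z =>
    have hz' : z.length = w.length := by simpa using hz
    by_cases h : i = 0 ∧ unmatchedClose w ≠ 0
    · have hu := unmatched_cons_matched h
      have e1 := ih (1 :: x) z (by simp [hx, hu]) hz'
      have e0 := ih (0 :: x) z (by simp [hx, hu]) hz'
      simp only [List.length_cons, wordSum, tensorCoeff, singletInsertion_matched h]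
      simp only [one_ne_zero, if_true, if_false, map_neg, mul_neg, mul_assoc]
      rw [wordSum_mul_left, e1]
      have : ∀ y, -(β j 1 * (tensorCoeff β z y * algebraMap ℂ 𝒜 (singletInsertion w (0 :: x) y)))
        = (-β j 1) * (tensorCoeff β z y * algebraMap ℂ 𝒜 (singletInsertion w (0 :: x) y)) := by
        intro y; ring
      simp only [this]
      rw [wordSum_mul_left, e0, ← hu]
      simp only [wordSum, tensorCoeff, mul_add, ← wordSum_mul_left, ← wordSum_add]
      refine wordSum_congr _ fun x' _ => ?_
      -- Summing over the letter `k` of the partner leaves `β j 0 * β k 1 - β j 1 * β k 0`, which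
      -- vanishes for `k = j` and is plus or minus the determinant otherwise.
      fin_cases j
      · simp
        linear_combination algebraMap ℂ 𝒜 (singletInsertion w (1 :: x') z) * tensorCoeff β x' x * hβ
      · simp
        linear_combination -algebraMap ℂ 𝒜 (singletInsertion w (0 :: x') z) * tensorCoeff β x' x * hβ
    · have hu := unmatched_cons_unmatched h
      match x with
      | [] => simp [hu] at hx
      | k :: x =>
      have hx' : x.length = unmatched w := by simpa [hu] using hx
      have e := ih x z hx' hz'
      rw [hu]
      simp only [List.length_cons, wordSum, tensorCoeff, singletInsertion_unmatched h]
      fin_cases k <;> fin_cases j <;>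
        simp [wordSum_zero, mul_assoc, wordSum_mul_left, e, ← mul_left_comm (β _ _)]

/-- The singlets absorb all factors of `β` on matched letters, so the degree in the entries of `β`
drops from the length of `w` to `unmatched w`. -/
theorem wordSum_tensorCoeff_wordTensor_mem (β : Fin 2 → Fin 2 → 𝒜)
    (hβ : β 0 0 * β 1 1 - β 0 1 * β 1 0 = 1) (V : Submodule ℂ 𝒜) (hV : ∀ i j, β i j ∈ V)
    (w z : List (Fin 2)) (hz : z.length = w.length) :
    wordSum w.length (fun y => tensorCoeff β z y * algebraMap ℂ 𝒜 (wordTensor w y)) ∈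
      V ^ unmatched w := by
  simp only [wordTensor]
  rw [wordSum_tensorCoeff_singletInsertion β hβ w _ z (unmatchedWord_length w) hz]
  refine wordSum_mem _ _ _ fun x' _ => ?_
  rw [← Algebra.smul_def]
  refine Submodule.smul_mem _ _ ?_
  have := tensorCoeff_mem β V hV x' (unmatchedWord w)
  rwa [unmatchedWord_length] at this

end Words

/-! ### Dimensions of spin parts by counting walks, and their tail bounds. -/

section Counting

/-- `walkSum L A` is the sum of `A k` over all walks of `L` unit steps on the natural numbers that
start at `0` and end at `k`. -/
def walkSum : ℕ → (ℕ → ℝ) → ℝ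
  | 0, A => A 0
  | L + 1, A => walkSum L fun k => A (k + 1) + if k = 0 then 0 else A (k - 1)

theorem walkSum_mono (L : ℕ) {A A' : ℕ → ℝ}
    (h : ∀ k ≤ L, k % 2 = L % 2 → A k ≤ A' k) : walkSum L A ≤ walkSum L A' := by
  induction L generalizing A A' with
  | zero => exact h 0 le_rfl rfl
  | succ L ih =>
    refine ih fun k hk hp => add_le_add (h _ (by omega) (by omega)) ?_
    split_ifs with h0
    · exact le_rfl
    · exact h _ (by omega) (by omega)

theorem walkSum_congr (L : ℕ) {A A' : ℕ → ℝ}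
    (h : ∀ k ≤ L, k % 2 = L % 2 → A k = A' k) : walkSum L A = walkSum L A' :=
  le_antisymm (walkSum_mono L fun k hk hp => (h k hk hp).le)
    (walkSum_mono L fun k hk hp => (h k hk hp).ge)

theorem walkSum_add (L : ℕ) (A A' : ℕ → ℝ) :
    walkSum L (fun k => A k + A' k) = walkSum L A + walkSum L A' := by
  induction L generalizing A A' with
  | zero => rfl
  | succ L ih =>
    simp only [walkSum]
    rw [← ih]
    refine walkSum_congr L fun k _ _ => ?_
    split_ifs <;> ring

theorem walkSum_mul_left (L : ℕ) (r : ℝ) (A : ℕ → ℝ) :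
    walkSum L (fun k => r * A k) = r * walkSum L A := by
  induction L generalizing A with
  | zero => rfl
  | succ L ih =>
    simp only [walkSum]
    rw [← ih]
    refine walkSum_congr L fun k _ _ => ?_
    split_ifs <;> ring

theorem walkSum_zero (L : ℕ) : walkSum L (fun _ => 0) = 0 := by
  simpa using walkSum_mul_left L 0 fun _ => 0

/-- If `h` is odd at the boundary, the reflected walk acts on it as the free one. -/
theorem walkSum_succ_of_zero (L : ℕ) (h : ℕ → ℝ) (h0 : h 0 = 0) :
    walkSum (L + 1) (fun k => h (k + 1)) = walkSum L fun k => h (k + 2) + h k := by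
  refine walkSum_congr L fun k _ _ => ?_
  rcases k with _ | k
  · simp [h0]
  · simp

/-- After division by `sinh t`, the character of `L` qubits expanded in the characters `sinh (t (k +
1)) / sinh t` of spin `k / 2`; it serves as moment generating function in the Chernoff bound. -/
theorem walkSum_sinh (L : ℕ) (t : ℝ) :
    walkSum L (fun k => Real.sinh (t * ((k : ℝ) + 1))) = (2 * Real.cosh t) ^ L * Real.sinh t := by
  induction L with
  | zero => simp [walkSum]
  | succ L ih =>
    have := walkSum_succ_of_zero L (fun k => Real.sinh (t * k)) (by simp)
    push_cast at this
    rw [this, walkSum_congr L (A' := fun k => 2 * Real.cosh t * Real.sinh (t * ((k : ℝ) + 1))),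
      walkSum_mul_left, ih]
    · ring
    · intro k _ _
      rw [show t * ((k : ℝ) + 2) = t * (k + 1) + t by ring,
        show t * (k : ℝ) = t * (k + 1) - t by ring, Real.sinh_add, Real.sinh_sub]
      ring

theorem walkSum_dim (L : ℕ) : walkSum L (fun k => (k : ℝ) + 1) = 2 ^ L := by
  induction L with
  | zero => simp [walkSum]
  | succ L ih =>
    have := walkSum_succ_of_zero L (fun k => (k : ℝ)) (by simp)
    push_cast at this
    rw [this, walkSum_congr L (A' := fun k => 2 * ((k : ℝ) + 1)) (fun k _ _ => by ring),
      walkSum_mul_left, ih]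
    ring

/-- The trace of the Casimir operator. -/
theorem walkSum_casimir (L : ℕ) :
    walkSum L (fun k => ((k : ℝ) + 1) ^ 3 - ((k : ℝ) + 1)) = 3 * L * 2 ^ L := by
  induction L with
  | zero => simp [walkSum]
  | succ L ih =>
    have := walkSum_succ_of_zero L (fun k => (k : ℝ) ^ 3 - k) (by simp)
    push_cast at this
    rw [this, walkSum_congr L (A' := fun k => 2 * (((k : ℝ) + 1) ^ 3 - ((k : ℝ) + 1)) +
      6 * ((k : ℝ) + 1)) (fun k _ _ => by ring), walkSum_add, walkSum_mul_left, walkSum_mul_left,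
      ih, walkSum_dim]
    push_cast
    ring

/-- Let `(a, b)` count unmatched closings and openings. Prepending `1` gives `(a + 1, b)`;
prepending `0` gives `(a - 1, b)`, or `(0, b + 1)` if `a = 0`. So the antidiagonal `k` is carried
bijectively onto the antidiagonals `k + 1` and `k - 1`, which is a step of the walk. -/
theorem wordSum_eq_walkSum (L : ℕ) (f : ℕ → ℕ → ℝ) :
    wordSum L (fun w => f (unmatchedClose w) (unmatchedOpen w)) =
      walkSum L fun k => ∑ p ∈ Finset.HasAntidiagonal.antidiagonal k, f p.1 p.2 := by
  induction L generalizing f with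
  | zero => simp [wordSum, walkSum, unmatchedClose, unmatchedOpen]
  | succ L ih =>
    rw [wordSum, ← wordSum_add]
    have := ih fun a b => (if a = 0 then f 0 (b + 1) else f (a - 1) b) + f (a + 1) b
    rw [wordSum_congr L (f' := fun w => (if unmatchedClose w = 0 then f 0 (unmatchedOpen w + 1)
      else f (unmatchedClose w - 1) (unmatchedOpen w)) +
        f (unmatchedClose w + 1) (unmatchedOpen w)), this, walkSum]
    · refine walkSum_congr L fun k _ _ => ?_
      rw [Finset.sum_add_distrib, Finset.Nat.antidiagonal_succ, Finset.sum_cons, Finset.sum_map]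
      rcases k with _ | k
      · simp
      · rw [Finset.Nat.antidiagonal_succ, Finset.sum_cons, Finset.sum_map]
        simp
        ring
    · intro w _
      congr 1
      by_cases h : unmatchedClose w = 0 <;> simp [unmatchedClose, unmatchedOpen, h]

theorem wordSum_unmatched (L : ℕ) (φ : ℕ → ℝ) :
    wordSum L (fun w => φ (unmatched w)) = walkSum L fun k => ((k : ℝ) + 1) * φ k := by
  refine (wordSum_eq_walkSum L fun a b => φ (a + b)).trans ?_
  refine walkSum_congr L fun k _ _ => ?_
  rw [Finset.sum_congr rfl (g := fun _ => φ k)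
    fun p hp => by rw [Finset.HasAntidiagonal.mem_antidiagonal.1 hp]]
  simp

/-- The number of words of length `L` with at most `n` letters without a partner, which is the
dimension of the part of total spin at most `n / 2`. -/
noncomputable def lowSpinDim (L n : ℕ) : ℝ :=
  walkSum L fun k => ((k : ℝ) + 1) * if k ≤ n then 1 else 0

/-- The dimension of the part of total spin above `n / 2`. -/
noncomputable def highSpinDim (L n : ℕ) : ℝ :=
  walkSum L fun k => if k ≤ n then 0 else (k : ℝ) + 1

theorem lowSpinDim_eq (L n : ℕ) : lowSpinDim L n = 2 ^ L - highSpinDim L n := by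
  rw [lowSpinDim, highSpinDim, eq_sub_iff_add_eq, ← walkSum_add, ← walkSum_dim]
  refine walkSum_congr L fun k _ _ => ?_
  split_ifs <;> simp

theorem highSpinDim_of_le {L n : ℕ} (h : L ≤ n) : highSpinDim L n = 0 := by
  rw [highSpinDim, walkSum_congr L (A' := fun _ => 0) fun k hk _ => if_pos (hk.trans h),
    walkSum_zero]

theorem one_le_walkSum (L : ℕ) : 1 ≤ walkSum L fun k => if k ≤ 1 then 1 else 0 := by
  induction L with
  | zero => simp [walkSum]
  | succ L ih =>
    refine ih.trans (walkSum_mono L fun k _ _ => ?_)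
    rcases k with _ | _ | k
    · simp
    · simp
    · simp only [Nat.add_sub_cancel]; split_ifs <;> simp_all

theorem lowSpinDim_pos {L n : ℕ} (h : L % 2 = n % 2) : 0 < lowSpinDim L n := by
  refine zero_lt_one.trans_le ((one_le_walkSum L).trans (walkSum_mono L fun k _ hp => ?_))
  split_ifs with h1 h2
  · simp
  -- Here `k = 1` and `n = 0`, which parity forbids.
  · omega
  · positivity
  · simp

/-- A Chernoff bound for the total spin. -/
theorem highSpinDim_le_exp {L n : ℕ} (h : L % 2 = n % 2) :
    highSpinDim L n ≤ 2 ^ L * (((L : ℝ) + 1) * Real.exp (-((n : ℝ) + 2) ^ 2 / (2 * L))) := by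
  rcases Nat.eq_zero_or_pos L with rfl | hL
  · rw [highSpinDim_of_le (Nat.zero_le n)]; positivity
  have hL' : (0 : ℝ) < L := by exact_mod_cast hL
  -- The minimizer of `L * t ^ 2 / 2 - t * (n + 2)`, the exponent left by `cosh t ≤ exp (t ^ 2 /
  -- 2)`.
  set t : ℝ := ((n : ℝ) + 2) / L with ht
  have htpos : 0 < t := by positivity
  have hs : 0 < Real.sinh t := Real.sinh_pos_iff.2 htpos
  have hsinh : ∀ k : ℕ, Real.sinh t * Real.exp (t * k) ≤ Real.sinh (t * ((k : ℝ) + 1)) := by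
    intro k
    rw [mul_add, mul_one, add_comm, Real.sinh_add, ← Real.cosh_add_sinh]
    have h1 : 0 ≤ Real.sinh (t * k) := Real.sinh_nonneg_iff.2 (by positivity)
    have := mul_le_mul_of_nonneg_right (Real.sinh_lt_cosh t).le h1
    linarith
  have hbound : highSpinDim L n ≤
      ((L : ℝ) + 1) * Real.exp (-(t * (n + 2))) / Real.sinh t *
        ((2 * Real.cosh t) ^ L * Real.sinh t) := by
    rw [← walkSum_sinh, ← walkSum_mul_left]
    refine walkSum_mono L fun k hk hp => ?_
    have hnn : 0 ≤ Real.sinh (t * ((k : ℝ) + 1)) := Real.sinh_nonneg_iff.2 (by positivity)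
    split_ifs with hkn
    · positivity
    -- By parity the first value above `n` is `n + 2`; the gain later absorbs the discarded refbit.
    · have hkn' : (n : ℝ) + 2 ≤ k := by exact_mod_cast (by omega : n + 2 ≤ k)
      have hkL : (k : ℝ) ≤ L := by exact_mod_cast hk
      calc (k : ℝ) + 1 ≤ ((L : ℝ) + 1) * 1 := by linarith
        _ ≤ ((L : ℝ) + 1) * (Real.exp (-(t * (n + 2))) * Real.exp (t * k)) := by
            rw [← Real.exp_add]
            gcongr
            rw [Real.one_le_exp_iff]
            nlinarith
        _ = ((L : ℝ) + 1) * Real.exp (-(t * (n + 2))) / Real.sinh t *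
              (Real.sinh t * Real.exp (t * k)) := by field_simp
        _ ≤ _ := by gcongr; exact hsinh k
  refine hbound.trans ?_
  have hcosh : Real.cosh t ^ L ≤ Real.exp (t ^ 2 / 2) ^ L :=
    pow_le_pow_left₀ (Real.cosh_pos t).le (Real.cosh_le_exp_half_sq t) L
  calc ((L : ℝ) + 1) * Real.exp (-(t * (n + 2))) / Real.sinh t *
        ((2 * Real.cosh t) ^ L * Real.sinh t)
      = 2 ^ L * (((L : ℝ) + 1) * (Real.exp (-(t * (n + 2))) * Real.cosh t ^ L)) := by
        rw [mul_pow]; field_simp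
    _ ≤ 2 ^ L * (((L : ℝ) + 1) * (Real.exp (-(t * (n + 2))) * Real.exp (t ^ 2 / 2) ^ L)) := by
        gcongr
    _ = _ := by
        rw [← Real.exp_nat_mul, ← Real.exp_add, ht]
        congr 3
        field_simp
        ring

/-- A Markov bound for the total spin. -/
theorem highSpinDim_mul_sq_le (L n : ℕ) :
    highSpinDim L n * (n : ℝ) ^ 2 ≤ 2 ^ L * (3 * L) := by
  rw [show (2 : ℝ) ^ L * (3 * L) = 3 * L * 2 ^ L by ring, ← walkSum_casimir, mul_comm, highSpinDim,
    ← walkSum_mul_left]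
  refine walkSum_mono L fun k _ _ => ?_
  have hk0 : (0 : ℝ) ≤ k := Nat.cast_nonneg k
  have hn0 : (0 : ℝ) ≤ n := Nat.cast_nonneg n
  split_ifs with hkn
  · nlinarith [mul_nonneg hk0 hk0, mul_nonneg hk0 (mul_nonneg hk0 hk0)]
  · have hkn' : (n : ℝ) ≤ k := by exact_mod_cast (not_le.1 hkn).le
    -- The Casimir summand factors as `(k + 1) * (k * (k + 2))`.
    have : (n : ℝ) ^ 2 ≤ (k : ℝ) * (k + 2) := by nlinarith
    nlinarith

end Counting

/-! ### Quantum operations from Kraus families. -/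

section Kraus

theorem norm_sum_mul_sq_le {ι : Type*} (s : Finset ι) (a b : ι → ℂ) :
    ‖∑ k ∈ s, a k * b k‖ ^ 2 ≤ (∑ k ∈ s, ‖a k‖ ^ 2) * ∑ k ∈ s, ‖b k‖ ^ 2 := by
  refine le_trans ?_ (Finset.sum_mul_sq_le_sq_mul_sq s (fun k => ‖a k‖) fun k => ‖b k‖)
  refine pow_le_pow_left₀ (norm_nonneg _) ((norm_sum_le _ _).trans ?_) 2
  simp

variable {m n κ : Type*} [Fintype m] [Fintype n] [Fintype κ]

theorem trace_conjTranspose_mul_self_re (A : Matrix n m ℂ) :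
    (Aᴴ * A).trace = ((∑ i, ∑ j, ‖A i j‖ ^ 2 : ℝ) : ℂ) := by
  simp only [Matrix.trace, Matrix.diag, Matrix.mul_apply, Matrix.conjTranspose_apply]
  rw [Finset.sum_comm]
  push_cast
  refine Finset.sum_congr rfl fun i _ => Finset.sum_congr rfl fun j _ => ?_
  rw [← Complex.conj_mul']
  rfl

open scoped MatrixOrder Matrix.Norms.L2Operator in
theorem exists_eq_conjTranspose_mul_self {ρ : Matrix m m ℂ} (hρ : ρ.PosSemidef) :
    ∃ S : Matrix m m ℂ, ρ = Sᴴ * S := by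
  classical
  exact CStarAlgebra.nonneg_iff_eq_star_mul_self.1 hρ.nonneg

/-- Cauchy-Schwarz on the entries of `S * Tᴴ`, where `ρ = Sᴴ * S`. The Frobenius norm is a crude
constant, but any constant will do: rescaling a machine changes its success probability and not its
fidelity. -/
theorem trace_mul_conjTranspose_le (T : Matrix n m ℂ) {ρ : Matrix m m ℂ} (hρ : ρ.PosSemidef) :
    (T * ρ * Tᴴ).trace.re ≤ (∑ i, ∑ j, ‖T i j‖ ^ 2) * ρ.trace.re := by
  obtain ⟨S, rfl⟩ := exists_eq_conjTranspose_mul_self hρ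
  have h1 : T * (Sᴴ * S) * Tᴴ = (S * Tᴴ)ᴴ * (S * Tᴴ) := by
    simp [Matrix.conjTranspose_mul, Matrix.mul_assoc]
  rw [h1, trace_conjTranspose_mul_self_re, trace_conjTranspose_mul_self_re, Complex.ofReal_re,
    Complex.ofReal_re]
  calc ∑ i, ∑ j, ‖(S * Tᴴ) i j‖ ^ 2
      ≤ ∑ i, ∑ j, (∑ k, ‖S i k‖ ^ 2) * ∑ k, ‖T j k‖ ^ 2 := by
        refine Finset.sum_le_sum fun i _ => Finset.sum_le_sum fun j _ => ?_
        rw [Matrix.mul_apply]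
        refine (norm_sum_mul_sq_le _ _ _).trans (le_of_eq ?_)
        simp [Matrix.conjTranspose_apply]
    _ = _ := by
        rw [Finset.sum_comm, Finset.sum_mul]
        refine Finset.sum_congr rfl fun j _ => ?_
        rw [Finset.mul_sum]
        exact Finset.sum_congr rfl fun i _ => mul_comm _ _

/-- Any finite family of matrices is, up to a scalar, the Kraus decomposition of a quantum
operation. -/
theorem exists_quantumOperation (T : κ → Matrix n m ℂ) :
    ∃ (Q : QuantumOperation m n) (r : ℝ), 0 < r ∧
      ∀ ρ, Q.toLinearMap ρ = (r : ℂ) • ∑ k, T k * ρ * (T k)ᴴ := by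
  classical
  -- The summand `1` keeps `s` invertible for a zero or empty family.
  set s : ℝ := 1 + ∑ k, ∑ i, ∑ j, ‖T k i j‖ ^ 2 with hs
  have hs0 : 0 ≤ ∑ k, ∑ i, ∑ j, ‖T k i j‖ ^ 2 := by positivity
  have hspos : 0 < s := by positivity
  let φ : Matrix m m ℂ →ₗ[ℂ] Matrix n n ℂ :=
    { toFun := fun ρ => ((s⁻¹ : ℝ) : ℂ) • ∑ k, T k * ρ * (T k)ᴴ
      map_add' := fun ρ σ => by
        simp only [Matrix.mul_add, Matrix.add_mul, Finset.sum_add_distrib, smul_add]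
      map_smul' := fun z ρ => by
        simp only [Matrix.mul_smul, Matrix.smul_mul, ← Finset.smul_sum, RingHom.id_apply]
        rw [smul_comm] }
  refine ⟨⟨φ, ?_, ?_⟩, s⁻¹, inv_pos.2 hspos, fun ρ => rfl⟩
  · intro l X hX
    -- The Kraus operators `1 ⊗ T k` of the extended map.
    let V : κ → Matrix (Fin l × n) (Fin l × m) ℂ := fun k =>
      Matrix.of fun p a => if p.1 = a.1 then T k p.2 a.2 else 0
    have hV : (Matrix.of fun p q : Fin l × n =>
        φ (Matrix.of fun a b => X (p.1, a) (q.1, b)) p.2 q.2) =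
          ((s⁻¹ : ℝ) : ℂ) • ∑ k, V k * X * (V k)ᴴ := by
      ext ⟨p, i⟩ ⟨q, j⟩
      simp only [φ, V, LinearMap.coe_mk, AddHom.coe_mk, Matrix.of_apply, Matrix.smul_apply,
        Matrix.sum_apply, Matrix.mul_apply, Matrix.conjTranspose_apply, Fintype.sum_prod_type,
        ite_mul, zero_mul, apply_ite star, star_zero, mul_ite, mul_zero]
      congr 1
      refine Finset.sum_congr rfl fun k _ => ?_
      rw [Finset.sum_eq_single q (fun b _ hb => by simp [hb.symm]) (by simp)]
      simp only [if_true]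
      refine Finset.sum_congr rfl fun b _ => ?_
      congr 1
      rw [Finset.sum_eq_single p (fun b _ hb => by simp [hb.symm]) (by simp)]
      simp
    rw [hV]
    refine Matrix.PosSemidef.smul (Matrix.posSemidef_sum _ fun k _ =>
      hX.mul_mul_conjTranspose_same (V k)) ?_
    exact_mod_cast (inv_pos.2 hspos).le
  · intro ρ hρ
    have hρ0 : 0 ≤ ρ.trace.re := (Complex.le_def.1 hρ.trace_nonneg).1
    have h1 : (∑ k, T k * ρ * (T k)ᴴ).trace.re ≤ s * ρ.trace.re := by
      rw [Matrix.trace_sum, Complex.re_sum]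
      calc ∑ k, (T k * ρ * (T k)ᴴ).trace.re
          ≤ ∑ k, (∑ i, ∑ j, ‖T k i j‖ ^ 2) * ρ.trace.re :=
            Finset.sum_le_sum fun k _ => trace_mul_conjTranspose_le (T k) hρ
        _ ≤ s * ρ.trace.re := by
            rw [← Finset.sum_mul, hs]
            gcongr
            linarith
    show (((s⁻¹ : ℝ) : ℂ) • ∑ k, T k * ρ * (T k)ᴴ).trace.re ≤ _
    rw [Matrix.trace_smul, smul_eq_mul, Complex.re_ofReal_mul, inv_mul_le_iff₀ hspos]
    exact h1

omit [Fintype n] in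
theorem mul_pureState_mul (T : Matrix n m ℂ) (ψ : m → ℂ) :
    T * pureState ψ * Tᴴ = pureState (T *ᵥ ψ) := by
  rw [pureState, pureState, Matrix.mul_vecMulVec, Matrix.vecMulVec_mul, Matrix.star_mulVec]

theorem trace_pureState (φ : n → ℂ) : (pureState φ).trace = ((∑ i, ‖φ i‖ ^ 2 : ℝ) : ℂ) := by
  simp only [pureState, Matrix.trace, Matrix.diag, Matrix.vecMulVec_apply, Pi.star_apply]
  push_cast
  exact Finset.sum_congr rfl fun i _ => Complex.mul_conj' _

theorem dotProduct_pureState_mulVec (χ φ : n → ℂ) :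
    star χ ⬝ᵥ (pureState φ *ᵥ χ) = ((‖star χ ⬝ᵥ φ‖ ^ 2 : ℝ) : ℂ) := by
  rw [pureState, Matrix.vecMulVec_mulVec]
  have h : star φ ⬝ᵥ χ = star (star χ ⬝ᵥ φ) := by
    rw [Matrix.star_dotProduct]
  push_cast
  rw [← Complex.mul_conj', h]
  simp [dotProduct_smul, mul_comm]

end Kraus

/-! ### Amplitudes of rotated Bell states as matrix coefficients. -/

section Bell

/-- The entries of a matrix in `SU(2)`, as functions. -/
def entry (i j : Fin 2) : SU2 → ℂ := fun g => g.1 i j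

theorem entry_det : entry 0 0 * entry 1 1 - entry 0 1 * entry 1 0 = 1 := by
  funext g
  have := (Matrix.mem_specialUnitaryGroup_iff.1 g.2).2
  rw [Matrix.det_fin_two] at this
  simpa [entry] using this

theorem rotatedBellState_apply (d : ℕ) (g : SU2) (p : SpinPair d) :
    rotatedBellState d g p = spinMatrix d g p.1 p.2 * ((1 / Real.sqrt (d + 1) : ℝ) : ℂ) := by
  simp only [rotatedBellState, Matrix.mulVec, dotProduct, bellState, Fintype.sum_prod_type,
    Matrix.kroneckerMap_apply, Matrix.one_apply]
  rw [Finset.sum_eq_single p.2]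
  · rw [Finset.sum_eq_single p.2]
    · simp
    · intro b _ hb; simp [hb.symm]
    · simp
  · intro b _ hb
    refine Finset.sum_eq_zero fun q _ => ?_
    by_cases hq : p.2 = q
    · subst hq; simp [hb]
    · simp [hq]
  · simp

theorem spinMatrix_eq (d : ℕ) (g : SU2) (l k : Fin (d + 1)) :
    spinMatrix d g l k = ((Real.sqrt (d.choose k) / Real.sqrt (d.choose l) : ℝ) : ℂ) *
      (rowPoly (entry 0 0) (entry 0 1) (entry 1 0) (entry 1 1) k (d - k)).coeff l g := by
  have h : ∀ P : Polynomial (SU2 → ℂ), P.coeff l g =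
      (P.map (Pi.evalRingHom (fun _ : SU2 => ℂ) g)).coeff l := by
    intro P
    rw [Polynomial.coeff_map]
    rfl
  rw [h]
  simp [spinMatrix, rowPoly, entry]

theorem coeffSpace_le_span (d : ℕ) :
    coeffSpace (entry 0 0) (entry 0 1) (entry 1 0) (entry 1 1) d ≤
      Submodule.span ℂ (Set.range fun (p : SpinPair d) (g : SU2) => rotatedBellState d g p) := by
  rw [coeffSpace, Submodule.span_le]
  rintro _ ⟨k, l, m, hkl, rfl⟩
  -- `coeffSpace` admits every coefficient index; those above the degree `d` contribute zero.
  rcases lt_or_ge d m with hm | hm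
  · have hdeg : (rowPoly (entry 0 0) (entry 0 1) (entry 1 0) (entry 1 1) k l).natDegree ≤ d := by
      rw [← hkl, rowPoly]
      refine Polynomial.natDegree_mul_le_of_le ?_ ?_
      · simpa using Polynomial.natDegree_pow_le_of_le k Polynomial.natDegree_linear_le
      · simpa using Polynomial.natDegree_pow_le_of_le l Polynomial.natDegree_linear_le
    rw [Polynomial.coeff_eq_zero_of_natDegree_lt (hdeg.trans_lt hm)]
    exact Submodule.zero_mem _
  · let p : SpinPair d := (⟨m, by omega⟩, ⟨k, by omega⟩)
    have hmem : (fun g : SU2 => rotatedBellState d g p) ∈ Submodule.span ℂ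
        (Set.range fun (p : SpinPair d) (g : SU2) => rotatedBellState d g p) :=
      Submodule.subset_span ⟨p, rfl⟩
    have hmem' := Submodule.smul_mem _ ((Real.sqrt (d.choose m) / Real.sqrt (d.choose k) *
      Real.sqrt (d + 1) : ℝ) : ℂ) hmem
    refine (congrArg (· ∈ Submodule.span ℂ _) ?_).mpr hmem'
    funext g
    have h1 : (Real.sqrt (d.choose m) : ℂ) ≠ 0 := by
      have := Nat.choose_pos hm
      exact_mod_cast (Real.sqrt_pos.2 (by exact_mod_cast this)).ne'
    have h2 : (Real.sqrt (d.choose k) : ℂ) ≠ 0 := by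
      have := Nat.choose_pos (n := d) (k := k) (by omega)
      exact_mod_cast (Real.sqrt_pos.2 (by exact_mod_cast this)).ne'
    have h3 : (Real.sqrt (d + 1) : ℂ) ≠ 0 := by
      exact_mod_cast (Real.sqrt_pos.2 (by positivity)).ne'
    rw [Pi.smul_apply, rotatedBellState_apply, spinMatrix_eq, smul_eq_mul]
    obtain rfl : l = d - k := by omega
    simp only [p]
    push_cast
    field_simp

theorem coeffSpace_pow_le_span (N d : ℕ) :
    coeffSpace (entry 0 0) (entry 0 1) (entry 1 0) (entry 1 1) d ^ N ≤
      Submodule.span ℂ (Set.range fun (s : Fin N → SpinPair d) (g : SU2) => bellCopies N d g s) := by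
  induction N with
  | zero =>
    rw [pow_zero, Submodule.one_eq_span, Submodule.span_le, Set.singleton_subset_iff]
    exact Submodule.subset_span ⟨Fin.elim0, by funext g; simp [bellCopies]⟩
  | succ N ih =>
    rw [pow_succ']
    refine (mul_le_mul' (coeffSpace_le_span d) ih).trans ?_
    rw [Submodule.span_mul_span, Submodule.span_le]
    rintro _ ⟨_, ⟨p, rfl⟩, _, ⟨s, rfl⟩, rfl⟩
    refine Submodule.subset_span ⟨Fin.cons p s, ?_⟩
    funext g
    simp [bellCopies, Fin.prod_univ_succ]

/-- Functions in the span of the matrix coefficients of `N` spins are obtained from `N` rotated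
Bell states by a fixed linear functional. -/
theorem exists_eq_sum_bellCopies {N d : ℕ} {f : SU2 → ℂ}
    (hf : f ∈ coeffSpace (entry 0 0) (entry 0 1) (entry 1 0) (entry 1 1) d ^ N) :
    ∃ τ : (Fin N → SpinPair d) → ℂ, ∀ g, f g = ∑ s, τ s * bellCopies N d g s := by
  obtain ⟨τ, hτ⟩ := (Submodule.mem_span_range_iff_exists_fun ℂ).1 (coeffSpace_pow_le_span N d hf)
  exact ⟨τ, fun g => by rw [← hτ]; simp⟩

/-- The reversal arises because the basis index is the power of `x`, whereas `x` belongs to the row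
and column `0` of `g`. -/
theorem spinMatrix_one (g : SU2) (i j : Fin 2) :
    spinMatrix 1 g i j = g.1 (Fin.rev i) (Fin.rev j) := by
  fin_cases i <;> fin_cases j <;> simp [spinMatrix, Polynomial.coeff_X, Polynomial.coeff_C]

theorem sum_star_spinMatrix_one (g : SU2) (i j : Fin 2) :
    ∑ k : Fin 2, star (spinMatrix 1 g k i) * spinMatrix 1 g k j = if i = j then 1 else 0 := by
  have hU := (Matrix.mem_specialUnitaryGroup_iff.1 g.2).1
  have h := Matrix.mem_unitaryGroup_iff'.1 hU
  have h' := congrFun (congrFun h (Fin.rev i)) (Fin.rev j)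
  rw [Matrix.mul_apply] at h'
  simp only [spinMatrix_one]
  refine (Equiv.sum_comp Fin.revPerm
    fun k : Fin 2 => star (g.1 k (Fin.rev i)) * g.1 k (Fin.rev j)).trans ?_
  simpa [Matrix.star_apply, Matrix.one_apply, Fin.rev_inj] using h'

theorem continuous_spinMatrix_one (i j : Fin 2) : Continuous fun g : SU2 => spinMatrix 1 g i j := by
  simp only [spinMatrix_one]
  exact continuous_subtype_val.matrix_elem _ _

/-- The matrix of `g` on `L` spins `1/2`. -/
noncomputable def qubitsMatrix (L : ℕ) (g : SU2) : Matrix (Fin L → Fin 2) (Fin L → Fin 2) ℂ :=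
  Matrix.of fun z y => ∏ i, spinMatrix 1 g (z i) (y i)

theorem qubitsMatrix_unitary (L : ℕ) (g : SU2) : (qubitsMatrix L g)ᴴ * qubitsMatrix L g = 1 := by
  ext x y
  simp only [qubitsMatrix, Matrix.mul_apply, Matrix.conjTranspose_apply, Matrix.of_apply, star_prod,
    ← Finset.prod_mul_distrib]
  rw [← Fintype.prod_sum fun (i : Fin L) (k : Fin 2) =>
    star (spinMatrix 1 g k (x i)) * spinMatrix 1 g k (y i)]
  simp only [sum_star_spinMatrix_one, Matrix.one_apply, funext_iff]
  by_cases h : ∀ i, x i = y i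
  · simp [h]
  · rw [if_neg h]
    obtain ⟨i, hi⟩ := not_forall.1 h
    exact Finset.prod_eq_zero (Finset.mem_univ i) (if_neg hi)

theorem bellCopies_one (L : ℕ) (g : SU2) (s : Fin L → SpinPair 1) :
    bellCopies L 1 g s = qubitsMatrix L g (fun i => (s i).1) (fun i => (s i).2) *
      (((1 / Real.sqrt 2) ^ L : ℝ) : ℂ) := by
  simp only [bellCopies, rotatedBellState_apply, Finset.prod_mul_distrib, qubitsMatrix,
    Matrix.of_apply, Finset.prod_const, Finset.card_univ, Fintype.card_fin]
  norm_num

theorem bellCopies_append (M e δ : ℕ) (g : SU2) (t : Fin M → SpinPair e) (r : Fin δ → SpinPair e) :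
    bellCopies (M + δ) e g (Fin.append t r) = bellCopies M e g t * bellCopies δ e g r := by
  simp [bellCopies, Fin.prod_univ_add]

theorem continuous_bellCopies_one (L : ℕ) (s : Fin L → SpinPair 1) :
    Continuous fun g : SU2 => bellCopies L 1 g s := by
  simp only [bellCopies_one, qubitsMatrix, Matrix.of_apply]
  exact (continuous_finsetProd _ fun i _ => continuous_spinMatrix_one _ _).mul continuous_const

theorem sum_spinPairs {R : Type*} [AddCommMonoid R] (L : ℕ)
    (f : (Fin L → Fin 2) → (Fin L → Fin 2) → R) :
    ∑ s : Fin L → SpinPair 1, f (fun i => (s i).1) (fun i => (s i).2) = ∑ z, ∑ x, f z x := by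
  rw [← Fintype.sum_prod_type']
  exact (Equiv.arrowProdEquivProdArrow (Fin L) (fun _ => Fin 2) (fun _ => Fin 2)).sum_comp
    fun p => f p.1 p.2

end Bell

/-! ### The low spin subspace of `L` qubits. -/

section LowSpin

theorem tensorCoeff_ofFn {𝒜 : Type*} [CommRing 𝒜] (β : Fin 2 → Fin 2 → 𝒜) {L : ℕ}
    (x y : Fin L → Fin 2) :
    tensorCoeff β (List.ofFn x) (List.ofFn y) = ∏ i, β (x i) (y i) := by
  induction L with
  | zero => simp [tensorCoeff]
  | succ L ih => simp [List.ofFn_succ, tensorCoeff, Fin.prod_univ_succ, ih]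

/-- The tensor of a word, as a vector. -/
noncomputable def wordVector {L : ℕ} (w : Fin L → Fin 2) : EuclideanSpace ℂ (Fin L → Fin 2) :=
  WithLp.toLp 2 fun y => wordTensor (List.ofFn w) (List.ofFn y)

theorem linearIndependent_wordVector (L : ℕ) :
    LinearIndependent ℂ (wordVector : (Fin L → Fin 2) → EuclideanSpace ℂ (Fin L → Fin 2)) := by
  rw [Fintype.linearIndependent_iff]
  intro f hf w
  have h := eq_zero_of_wordSum_wordTensor L
    (fun w => if h : w.length = L then f fun i => w.get (i.cast h.symm) else 0) ?_ (List.ofFn w)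
    (by simp)
  · simpa using h
  · intro y hy
    obtain ⟨y, rfl⟩ : ∃ y' : Fin L → Fin 2, y = List.ofFn y' :=
      ⟨fun i => y.get (i.cast hy.symm), by subst hy; simp⟩
    have := congrArg (fun v : EuclideanSpace ℂ (Fin L → Fin 2) => v y) hf
    rw [wordSum_eq_sum]
    simpa [wordVector] using this

/-- The sum of the isotypic parts of total spin at most `n / 2`. -/
noncomputable def lowSpin (L n : ℕ) : Submodule ℂ (EuclideanSpace ℂ (Fin L → Fin 2)) :=
  Submodule.span ℂ (Set.range fun w : {w : Fin L → Fin 2 // unmatched (List.ofFn w) ≤ n} =>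
    wordVector w.1)

theorem finrank_lowSpin (L n : ℕ) : (Module.finrank ℂ (lowSpin L n) : ℝ) = lowSpinDim L n := by
  have h := finrank_span_eq_card ((linearIndependent_wordVector L).comp
    (Subtype.val : {w : Fin L → Fin 2 // unmatched (List.ofFn w) ≤ n} → Fin L → Fin 2)
    Subtype.val_injective)
  rw [lowSpin]
  refine (congrArg (Nat.cast : ℕ → ℝ) h).trans ?_
  rw [lowSpinDim,
    ← wordSum_unmatched L fun k => if k ≤ n then 1 else 0, wordSum_eq_sum, Fintype.card_subtype]
  simp

/-- On a word vector the entries have degree `unmatched w ≤ N * d` in the entries of `g`, and this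
degree has the parity of `L`, hence that of `N * d`. -/
theorem qubitsMatrix_mulVec_mem {L n N d : ℕ} (hN : 2 ≤ N) (hn : n = N * d)
    (hp : L % 2 = n % 2) {v : EuclideanSpace ℂ (Fin L → Fin 2)} (hv : v ∈ lowSpin L n)
    (z : Fin L → Fin 2) :
    (fun g => (qubitsMatrix L g *ᵥ v.ofLp) z) ∈
      coeffSpace (entry 0 0) (entry 0 1) (entry 1 0) (entry 1 1) d ^ N := by
  set S := coeffSpace (entry 0 0) (entry 0 1) (entry 1 0) (entry 1 1) d ^ N
  induction hv using Submodule.span_induction with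
  | mem v hv =>
    obtain ⟨⟨w, hw⟩, rfl⟩ := hv
    have hV : ∀ i j : Fin 2, (fun g => spinMatrix 1 g i j) ∈
        Submodule.span ℂ {entry 0 0, entry 0 1, entry 1 0, entry 1 1} := by
      intro i j
      have h : (fun g => spinMatrix 1 g i j) = entry (Fin.rev i) (Fin.rev j) := by
        funext g
        rw [spinMatrix_one, entry]
      rw [h]
      refine Submodule.subset_span ?_
      fin_cases i <;> fin_cases j <;> simp
    have hβ : (fun g => spinMatrix 1 g 0 0) * (fun g => spinMatrix 1 g 1 1) -
        (fun g => spinMatrix 1 g 0 1) * (fun g => spinMatrix 1 g 1 0) = (1 : SU2 → ℂ) := by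
      rw [← entry_det]
      funext g
      simp [spinMatrix_one, entry]
      ring
    have hmem := wordSum_tensorCoeff_wordTensor_mem (fun i j (g : SU2) => spinMatrix 1 g i j) hβ _
      hV (List.ofFn w) (List.ofFn z) (by simp)
    have hpar := unmatched_mod_two (List.ofFn w)
    simp only [List.length_ofFn] at hmem hpar
    rw [wordSum_eq_sum] at hmem
    have hle := span_pow_le_coeffSpace_pow entry_det (d := d) (N := N)
      (k := unmatched (List.ofFn w)) hN (hn ▸ hw) (by rw [hpar, hp, hn])
    convert hle hmem using 1
    funext g
    simp [Matrix.mulVec, dotProduct, qubitsMatrix, wordVector, tensorCoeff_ofFn]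
  | zero =>
    convert Submodule.zero_mem S using 1
    funext g
    simp
  | add u v _ _ hu hv =>
    convert Submodule.add_mem _ hu hv using 1
    funext g
    simp [Matrix.mulVec_add]
  | smul r u _ hu =>
    convert Submodule.smul_mem _ r hu using 1
    funext g
    simp [Matrix.mulVec_smul]

/-- An orthonormal basis of the low spin part, as the columns of a matrix. -/
theorem exists_lowSpin_isometry {L n N d : ℕ} (hN : 2 ≤ N) (hn : n = N * d)
    (hp : L % 2 = n % 2) :
    ∃ (r : ℕ) (O : Matrix (Fin L → Fin 2) (Fin r) ℂ), (r : ℝ) = lowSpinDim L n ∧ Oᴴ * O = 1 ∧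
      ∀ z i, (fun g => (qubitsMatrix L g * O) z i) ∈
        coeffSpace (entry 0 0) (entry 0 1) (entry 1 0) (entry 1 1) d ^ N := by
  let b := stdOrthonormalBasis ℂ (lowSpin L n)
  refine ⟨_, Matrix.of fun y i => (b i : EuclideanSpace ℂ (Fin L → Fin 2)) y,
    finrank_lowSpin L n, ?_, ?_⟩
  · ext i j
    have h := orthonormal_iff_ite.1 b.orthonormal i j
    rw [Submodule.coe_inner, PiLp.inner_apply] at h
    rw [Matrix.mul_apply, Matrix.one_apply, ← h]
    refine Finset.sum_congr rfl fun y _ => ?_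
    simp [mul_comm]
  · intro z i
    exact qubitsMatrix_mulVec_mem hN hn hp (b i).2 z

end LowSpin

/-! ### The machine, its fidelity and the final estimates. -/

section Machine

/-- The projection of `L` rotated Bell states of spin `1/2` to the low spin part is obtained from
`N` rotated Bell states of spin `d/2` by a fixed linear map. -/
theorem exists_projected_bellCopies {L N d : ℕ} (hN : 2 ≤ N) (hp : L % 2 = (N * d) % 2) :
    ∃ T : Matrix (Fin L → SpinPair 1) (Fin N → SpinPair d) ℂ,
      (∀ s, Continuous fun g => (T *ᵥ bellCopies N d g) s) ∧ ∀ g,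
      (∑ s, ‖(T *ᵥ bellCopies N d g) s‖ ^ 2 = lowSpinDim L (N * d) / 2 ^ L) ∧
      star (bellCopies L 1 g) ⬝ᵥ (T *ᵥ bellCopies N d g) =
        ((lowSpinDim L (N * d) / 2 ^ L : ℝ) : ℂ) := by
  obtain ⟨r, O, hr, hO, hmem⟩ := exists_lowSpin_isometry hN rfl hp
  -- `O * Oᴴ` is the projection to the low spin part, and the functionals `τ` become the rows of
  -- `T`.
  have hentry : ∀ s : Fin L → SpinPair 1, ∃ τ : (Fin N → SpinPair d) → ℂ, ∀ g,
      (qubitsMatrix L g * O * Oᴴ) (fun i => (s i).1) (fun i => (s i).2) *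
        (((1 / Real.sqrt 2) ^ L : ℝ) : ℂ) = ∑ u, τ u * bellCopies N d g u := by
    intro s
    refine exists_eq_sum_bellCopies
      (f := fun g => (qubitsMatrix L g * O * Oᴴ) (fun i => (s i).1) (fun i => (s i).2) *
        (((1 / Real.sqrt 2) ^ L : ℝ) : ℂ)) ?_
    have : (fun g => (qubitsMatrix L g * O * Oᴴ) (fun i => (s i).1) (fun i => (s i).2) *
        (((1 / Real.sqrt 2) ^ L : ℝ) : ℂ)) = ∑ i, (Oᴴ i (fun i => (s i).2) *
          (((1 / Real.sqrt 2) ^ L : ℝ) : ℂ)) •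
            fun g => (qubitsMatrix L g * O) (fun i => (s i).1) i := by
      funext g
      rw [Matrix.mul_apply, Finset.sum_mul]
      simp only [Finset.sum_apply, Pi.smul_apply, smul_eq_mul]
      exact Finset.sum_congr rfl fun i _ => by ring
    rw [this]
    exact Submodule.sum_mem _ fun i _ => Submodule.smul_mem _ _ (hmem _ i)
  choose T hT using hentry
  have hTg : ∀ g s, (Matrix.of T *ᵥ bellCopies N d g) s =
      (qubitsMatrix L g * O * Oᴴ) (fun i => (s i).1) (fun i => (s i).2) *
        (((1 / Real.sqrt 2) ^ L : ℝ) : ℂ) := fun g s => (hT s g).symm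
  refine ⟨Matrix.of T, fun s => ?_, fun g => ?_⟩
  · simp only [hTg]
    have hc : Continuous (qubitsMatrix L) :=
      continuous_matrix fun z y =>
        show Continuous fun g => ∏ i, spinMatrix 1 g (z i) (y i) from
          continuous_finsetProd _ fun i _ => continuous_spinMatrix_one _ _
    exact (((hc.matrix_mul continuous_const).matrix_mul continuous_const).matrix_elem _ _).mul
      continuous_const
  have hB := qubitsMatrix_unitary L g
  have hOtr : (O * Oᴴ).trace = (r : ℂ) := by
    rw [Matrix.trace_mul_comm, hO, Matrix.trace_one, Fintype.card_fin]
  have hsq : ((1 / Real.sqrt 2) ^ L) ^ 2 = (1 / 2 ^ L : ℝ) := by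
    rw [← pow_mul, mul_comm, pow_mul, div_pow, Real.sq_sqrt (by norm_num), one_pow, one_div_pow]
  constructor
  · have h1 : (qubitsMatrix L g * O * Oᴴ)ᴴ * (qubitsMatrix L g * O * Oᴴ) = O * Oᴴ := by
      simp only [Matrix.conjTranspose_mul, Matrix.conjTranspose_conjTranspose]
      calc O * (Oᴴ * (qubitsMatrix L g)ᴴ) * (qubitsMatrix L g * O * Oᴴ)
          = O * (Oᴴ * ((qubitsMatrix L g)ᴴ * qubitsMatrix L g) * O) * Oᴴ := by
            simp only [Matrix.mul_assoc]
        _ = _ := by rw [hB, Matrix.mul_one, hO, Matrix.mul_one]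
    have h2 := trace_conjTranspose_mul_self_re (qubitsMatrix L g * O * Oᴴ)
    rw [h1, hOtr] at h2
    have h3 : (r : ℝ) = ∑ i, ∑ j, ‖(qubitsMatrix L g * O * Oᴴ) i j‖ ^ 2 := by exact_mod_cast h2
    simp only [hTg, norm_mul, mul_pow, Complex.norm_real, Real.norm_eq_abs, sq_abs, hsq]
    rw [sum_spinPairs L fun z x => ‖(qubitsMatrix L g * O * Oᴴ) z x‖ ^ 2 * (1 / 2 ^ L)]
    simp only [← Finset.sum_mul]
    rw [← h3, hr]
    ring
  · have h1 : ((qubitsMatrix L g)ᴴ * (qubitsMatrix L g * O * Oᴴ)).trace = (r : ℂ) := by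
      rw [← Matrix.mul_assoc, ← Matrix.mul_assoc, hB, Matrix.one_mul, hOtr]
    have h2 : ∑ z, ∑ x, star (qubitsMatrix L g z x) * (qubitsMatrix L g * O * Oᴴ) z x = (r : ℂ) := by
      rw [← h1, Finset.sum_comm]
      rfl
    have hsqC : (((1 / Real.sqrt 2) ^ L : ℝ) : ℂ) * (((1 / Real.sqrt 2) ^ L : ℝ) : ℂ) =
        ((1 / 2 ^ L : ℝ) : ℂ) := by
      rw [← hsq]; push_cast; ring
    simp only [dotProduct, hTg, Pi.star_apply, bellCopies_one]
    rw [← hr]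
    calc ∑ s : Fin L → SpinPair 1, _
        = ∑ s : Fin L → SpinPair 1, (fun z x => star (qubitsMatrix L g z x) *
            (qubitsMatrix L g * O * Oᴴ) z x * ((1 / 2 ^ L : ℝ) : ℂ))
              (fun i => (s i).1) (fun i => (s i).2) := by
          refine Finset.sum_congr rfl fun s _ => ?_
          rw [← hsqC, star_mul, show star (((1 / Real.sqrt 2) ^ L : ℝ) : ℂ) =
            (((1 / Real.sqrt 2) ^ L : ℝ) : ℂ) from Complex.conj_ofReal _]
          ring
      _ = _ := by
          rw [sum_spinPairs L fun z x => star (qubitsMatrix L g z x) *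
            (qubitsMatrix L g * O * Oᴴ) z x * ((1 / 2 ^ L : ℝ) : ℂ)]
          simp only [← Finset.sum_mul]
          rw [h2]
          push_cast
          ring

theorem sum_append {R : Type*} [AddCommMonoid R] {α : Type*} [Fintype α] (M δ : ℕ)
    (f : (Fin (M + δ) → α) → R) :
    ∑ r : Fin δ → α, ∑ t : Fin M → α, f (Fin.append t r) = ∑ s, f s := by
  rw [Finset.sum_comm, ← Fintype.sum_prod_type', ← (Fin.appendEquiv M δ).sum_comp]
  rfl

theorem sum_norm_bellCopies_one (L : ℕ) (g : SU2) : ∑ s, ‖bellCopies L 1 g s‖ ^ 2 = 1 := by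
  have h := trace_conjTranspose_mul_self_re (qubitsMatrix L g)
  rw [qubitsMatrix_unitary, Matrix.trace_one] at h
  have h' : (2 : ℝ) ^ L = ∑ i, ∑ j, ‖qubitsMatrix L g i j‖ ^ 2 := by
    have h2 : ((Fintype.card (Fin L → Fin 2) : ℝ) : ℂ) =
        ((∑ i, ∑ j, ‖qubitsMatrix L g i j‖ ^ 2 : ℝ) : ℂ) := by rw [← h, Complex.ofReal_natCast]
    rw [← Complex.ofReal_injective h2]
    simp
  have hsq : ((1 / Real.sqrt 2) ^ L) ^ 2 = (1 / 2 ^ L : ℝ) := by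
    rw [← pow_mul, mul_comm, pow_mul, div_pow, Real.sq_sqrt (by norm_num), one_pow, one_div_pow]
  simp only [bellCopies_one, norm_mul, mul_pow, Complex.norm_real, Real.norm_eq_abs, sq_abs, hsq]
  rw [sum_spinPairs L fun z x => ‖qubitsMatrix L g z x‖ ^ 2 * (1 / 2 ^ L)]
  simp only [← Finset.sum_mul]
  rw [← h']
  field_simp

instance haarSU2.instIsProbabilityMeasure : MeasureTheory.IsProbabilityMeasure haarSU2 :=
  ⟨by
    simpa [haarSU2] using MeasureTheory.Measure.haarMeasure_self
      (K₀ := (⊤ : TopologicalSpace.PositiveCompacts SU2))⟩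

/-- Projecting to the low spin part of `M + δ` Bell states and discarding `δ` of them gives a
machine whose fidelity is at least the weight of the low spin part. -/
theorem exists_bellMachine {N d M δ : ℕ} (hN : 2 ≤ N) (hp : (M + δ) % 2 = (N * d) % 2) :
    ∃ 𝓜 : BellMachine N d M 1, 0 < 𝓜.successProb ∧
      lowSpinDim (M + δ) (N * d) / 2 ^ (M + δ) ≤ 𝓜.fidelity := by
  obtain ⟨T, hTc, hT⟩ := exists_projected_bellCopies hN hp
  set q : ℝ := lowSpinDim (M + δ) (N * d) / 2 ^ (M + δ) with hq
  have hqpos : 0 < q := div_pos (lowSpinDim_pos hp) (by positivity)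
  -- One Kraus operator for each basis state `r` of the discarded pairs, which traces them out after
  -- `T`.
  obtain ⟨𝓜, c, hc, h𝓜⟩ := exists_quantumOperation
    fun (r : Fin δ → SpinPair 1) => Matrix.of fun (t : Fin M → SpinPair 1) s => T (Fin.append t r) s
  have hout : ∀ g, BellMachine.output 𝓜 g = (c : ℂ) • ∑ r : Fin δ → SpinPair 1,
      pureState fun t : Fin M → SpinPair 1 => (T *ᵥ bellCopies N d g) (Fin.append t r) := by
    intro g
    rw [BellMachine.output, h𝓜]
    simp only [mul_pureState_mul]
    rfl
  have hsucc : BellMachine.successProb 𝓜 = c * q := by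
    have : ∀ g, (BellMachine.output 𝓜 g).trace.re = c * q := by
      intro g
      rw [hout, Matrix.trace_smul, Matrix.trace_sum, smul_eq_mul, Complex.re_ofReal_mul,
        Complex.re_sum]
      simp only [trace_pureState, Complex.ofReal_re]
      rw [sum_append M δ fun s => ‖(T *ᵥ bellCopies N d g) s‖ ^ 2, (hT g).1]
    simp [BellMachine.successProb, this]
  refine ⟨𝓜, hsucc ▸ mul_pos hc hqpos, ?_⟩
  let F : SU2 → ℝ := fun g => c * ∑ r : Fin δ → SpinPair 1, ‖star (bellCopies M 1 g) ⬝ᵥ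
      fun t : Fin M → SpinPair 1 => (T *ᵥ bellCopies N d g) (Fin.append t r)‖ ^ 2
  have hF : ∀ g, (star (bellCopies M 1 g) ⬝ᵥ
      (BellMachine.output 𝓜 g *ᵥ bellCopies M 1 g)).re = F g := by
    intro g
    rw [hout, Matrix.smul_mulVec, Matrix.sum_mulVec, dotProduct_smul, dotProduct_sum, smul_eq_mul,
      Complex.re_ofReal_mul, Complex.re_sum]
    simp only [dotProduct_pureState_mulVec, Complex.ofReal_re, F]
  have hlow : ∀ g, c * q ^ 2 ≤ F g := by
    intro g
    refine mul_le_mul_of_nonneg_left ?_ hc.le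
    -- The total overlap `q` is the pairing of the partial overlaps with the unit vector of the
    -- discarded pairs, so by Cauchy-Schwarz their squares sum to at least `q ^ 2`.
    have h1 : ∑ r : Fin δ → SpinPair 1, star (bellCopies δ 1 g r) * (star (bellCopies M 1 g) ⬝ᵥ
        fun t : Fin M → SpinPair 1 => (T *ᵥ bellCopies N d g) (Fin.append t r)) = (q : ℂ) := by
      rw [← (hT g).2, dotProduct, ← sum_append M δ]
      refine Finset.sum_congr rfl fun r _ => ?_
      rw [dotProduct, Finset.mul_sum]
      refine Finset.sum_congr rfl fun t _ => ?_
      rw [Pi.star_apply, Pi.star_apply, bellCopies_append, star_mul]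
      ring
    have h2 := norm_sum_mul_sq_le Finset.univ (fun r => star (bellCopies δ 1 g r))
      fun r : Fin δ → SpinPair 1 => star (bellCopies M 1 g) ⬝ᵥ
        fun t : Fin M → SpinPair 1 => (T *ᵥ bellCopies N d g) (Fin.append t r)
    rw [h1] at h2
    simpa [sum_norm_bellCopies_one, abs_of_pos hqpos] using h2
  have hcont : Continuous F := by
    refine continuous_const.mul (continuous_finsetSum _ fun r _ => (Continuous.norm ?_).pow 2)
    exact continuous_finsetSum _ fun t _ => (continuous_bellCopies_one M t).star.mul (hTc _)
  have hint : MeasureTheory.Integrable F haarSU2 :=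
    hcont.integrable_of_hasCompactSupport (HasCompactSupport.of_compactSpace F)
  have hle : c * q ^ 2 ≤ ∫ g, F g ∂haarSU2 := by
    have := MeasureTheory.integral_mono (MeasureTheory.integrable_const (c * q ^ 2)) hint hlow
    simpa using this
  rw [BellMachine.fidelity, hsucc, le_div_iff₀ (mul_pos hc hqpos)]
  simp only [hF]
  calc q * (c * q) = c * q ^ 2 := by ring
    _ ≤ _ := hle

/-- The condition on `N` stands inside the existential so that one choice defines machines for all
parameters, with the zero machine for `N < 2`; both claims then concern the same family. -/
theorem exists_bellMachine_highSpinDim (N d M : ℕ) :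
    ∃ 𝓜 : BellMachine N d M 1, 2 ≤ N → 0 < 𝓜.successProb ∧
      ∃ L, (L = M ∨ L = M + 1) ∧ L % 2 = (N * d) % 2 ∧
        1 - highSpinDim L (N * d) / 2 ^ L ≤ 𝓜.fidelity := by
  by_cases hN : 2 ≤ N
  · obtain ⟨δ, hδ, hp⟩ : ∃ δ, (δ = 0 ∨ δ = 1) ∧ (M + δ) % 2 = (N * d) % 2 := by
      by_cases h : M % 2 = (N * d) % 2
      · exact ⟨0, Or.inl rfl, h⟩
      · exact ⟨1, Or.inr rfl, by omega⟩
    obtain ⟨𝓜, hpos, hfid⟩ := exists_bellMachine hN hp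
    refine ⟨𝓜, fun _ => ⟨hpos, M + δ, by omega, hp, ?_⟩⟩
    rw [lowSpinDim_eq, sub_div, div_self (by positivity)] at hfid
    exact hfid
  · obtain ⟨Q, -⟩ := exists_quantumOperation (m := Fin N → SpinPair d) (n := Fin M → SpinPair 1)
      fun i : Fin 0 => i.elim0
    exact ⟨Q, fun h => absurd h hN⟩

/-- For `L = M + 1` the Chernoff prefactor is `M + 2`, one too many. Having `n + 2` rather than `n`
in the exponent gains a factor `exp (-2 / (M + 1))`, which compensates because `exp u ≥ 1 + u`. -/
theorem highSpinDim_div_le_exp {L M n : ℕ} (hL : L = M ∨ L = M + 1) (hp : L % 2 = n % 2) :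
    highSpinDim L n / 2 ^ L ≤ ((M : ℝ) + 1) * Real.exp (-((n : ℝ) ^ 2 / 2) / ((M : ℝ) + 1)) := by
  have h := (div_le_iff₀' (by positivity)).2 (highSpinDim_le_exp hp)
  rcases Nat.eq_zero_or_pos L with rfl | hL0
  · rw [highSpinDim_of_le (Nat.zero_le n), zero_div]; positivity
  refine h.trans ?_
  have hLpos : (0 : ℝ) < L := by exact_mod_cast hL0
  have hn0 : (0 : ℝ) ≤ n := Nat.cast_nonneg n
  rcases hL with rfl | rfl
  · gcongr ?_ * Real.exp ?_
    rw [neg_div, neg_div, neg_le_neg_iff, div_div]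
    refine div_le_div₀ (by positivity) (by nlinarith) (by positivity) (by linarith)
  · have hcast : ((M + 1 : ℕ) : ℝ) = (M : ℝ) + 1 := by push_cast; ring
    rw [hcast] at hLpos ⊢
    set x : ℝ := (M : ℝ) + 1
    have h1 : Real.exp (-((n : ℝ) + 2) ^ 2 / (2 * x)) ≤
        Real.exp (-((n : ℝ) ^ 2 / 2) / x) * Real.exp (-(2 / x)) := by
      rw [← Real.exp_add, Real.exp_le_exp]
      rw [show -((n : ℝ) ^ 2 / 2) / x + -(2 / x) = -((n : ℝ) ^ 2 + 4) / (2 * x) by field_simp; ring]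
      gcongr
      nlinarith
    have h2 : (x + 1) * Real.exp (-(2 / x)) ≤ x := by
      rw [Real.exp_neg, ← div_eq_mul_inv, div_le_iff₀ (Real.exp_pos _)]
      have h3 : x * (2 / x + 1) = 2 + x := by field_simp
      have := mul_le_mul_of_nonneg_left (Real.add_one_le_exp (2 / x)) hLpos.le
      linarith
    calc (x + 1) * Real.exp (-((n : ℝ) + 2) ^ 2 / (2 * x))
        ≤ (x + 1) * (Real.exp (-((n : ℝ) ^ 2 / 2) / x) * Real.exp (-(2 / x))) := by gcongr
      _ = (x + 1) * Real.exp (-(2 / x)) * Real.exp (-((n : ℝ) ^ 2 / 2) / x) := by ring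
      _ ≤ _ := by gcongr

theorem highSpinDim_div_le_of_le {L M n : ℕ} (hL : L = M ∨ L = M + 1) (hp : L % 2 = n % 2)
    {ε : ℝ} (hε : 0 ≤ ε) (hM : 6 * (M : ℝ) ≤ ε * (n : ℝ) ^ 2) : highSpinDim L n / 2 ^ L ≤ ε := by
  rcases le_or_gt L n with hLn | hLn
  · rw [highSpinDim_of_le hLn, zero_div]; exact hε
  -- If `M = 0`, then `n < L` forces `L = 1` and `n = 0`, against parity.
  have hM1 : 1 ≤ M := by omega
  have hn : n ≠ 0 := by
    rintro rfl
    have : (1 : ℝ) ≤ M := by exact_mod_cast hM1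
    norm_num at hM
    linarith
  have hL2 : (L : ℝ) ≤ 2 * M := by exact_mod_cast (by omega : L ≤ 2 * M)
  have hn2 : (0 : ℝ) < (n : ℝ) ^ 2 := by positivity
  rw [div_le_iff₀ (by positivity)]
  refine le_of_mul_le_mul_right ((highSpinDim_mul_sq_le L n).trans ?_) hn2
  calc (2 : ℝ) ^ L * (3 * L) ≤ 2 ^ L * (ε * (n : ℝ) ^ 2) :=
        mul_le_mul_of_nonneg_left (by linarith) (by positivity)
    _ = _ := by ring

end Machine

theorem proposition2 :
    ∃ 𝓜 : ∀ N d M : ℕ, BellMachine N d M 1,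
      (∀ N d M : ℕ, 2 ≤ N →
        0 < (𝓜 N d M).successProb ∧
        1 - ((M : ℝ) + 1) *
            Real.exp (-(2 * (N : ℝ) ^ 2 * ((d : ℝ) / 2) ^ 2) / ((M : ℝ) + 1)) ≤
          (𝓜 N d M).fidelity) ∧
      (∀ ε : ℝ, 0 < ε → ∃ δ : ℝ, 0 < δ ∧ ∀ N d M : ℕ, 2 ≤ N →
        (M : ℝ) ≤ δ * ((N : ℝ) ^ 2 * ((d : ℝ) / 2) ^ 2) →
          1 - ε ≤ (𝓜 N d M).fidelity) := by
  choose 𝓜 h𝓜 using exists_bellMachine_highSpinDim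
  -- With `n = N * d`, so that `N ^ 2 * J ^ 2 = n ^ 2 / 4`, the bound `M ≤ δ * N ^ 2 * J ^ 2` for `δ
  -- = 2 * ε / 3` is exactly `6 * M ≤ ε * n ^ 2`.
  refine ⟨𝓜, fun N d M hN => ?_, fun ε hε => ⟨2 * ε / 3, by positivity, fun N d M hN hM => ?_⟩⟩
  · obtain ⟨hpos, L, hL, hp, hfid⟩ := h𝓜 N d M hN
    refine ⟨hpos, le_trans (sub_le_sub_left ?_ 1) hfid⟩
    have h : 2 * (N : ℝ) ^ 2 * ((d : ℝ) / 2) ^ 2 = ((N * d : ℕ) : ℝ) ^ 2 / 2 := by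
      push_cast
      ring
    rw [h]
    exact highSpinDim_div_le_exp hL hp
  · obtain ⟨-, L, hL, hp, hfid⟩ := h𝓜 N d M hN
    refine le_trans (sub_le_sub_left (highSpinDim_div_le_of_le hL hp hε.le ?_) 1) hfid
    push_cast
    nlinarith
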